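/- Let $\Omega=\mathbb R^2/\Lambda$ be a flat torus, where $\Lambda$ is a lattice of rank two, and let $p_1,\dots,p_N\in\Omega$ be any points, repetitions allowed. For $\varepsilon>0$, a solution of $$(1-e^{v})\Delta v-e^{v}|\nabla v|^2+\frac1{\varepsilon^2}e^{v}(1-e^{v})^2=4\pi\sum_{j=1}^N\delta_{p_j}\quad\text{on }\Omega \qquad (1.1)$$ means a weak solution, with the first two terms read as $\operatorname{div}((1-e^v)\nabla v)$. That is, $v\in W^{1,1}(\Omega)$ is real-valued, $(1-e^v)\nabla v$ and $e^v(1-e^v)^2$ lie in $L^1(\Omega)$, and for every $\varphi\in C^\infty(\Omega)$ $$-\int_\Omega (1-e^v)\nabla v\cdot\nabla\varphi\,dx+\frac1{\varepsilon^2}\int_\Omega e^v(1-e^v)^2\varphi\,dx=4\pi\sum_{j=1}^N\varphi(p_j).$$ Theorem 1.1. Let $\varepsilon_n>0$ with $\varepsilon_n\to0$, and for each $n$ let $v_n$ be a solution of (1.1) with $\varepsilon=\varepsilon_n$. Then there is a subsequence $(v_{n_k})_k$ for which one of the following holds. (i) (topological type) $v_{n_k}\to0$ a.e. in $\Omega$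 as $k\to\infty$; moreover, for every $1<p<\infty$, all $v_{n_k}$ lie in $L^p(\Omega)$ and $v_{n_k}\to0$ in $L^p(\Omega)$. (ii) (non-topological type) $v_{n_k}\to-\infty$ a.e. in $\Omega$ as $k\to\infty$. -/

import Mathlib

noncomputable section

open MeasureTheory Filter Topology

/-- The Euclidean plane `ℝ²`. -/
abbrev Plane : Type := EuclideanSpace ℝ (Fin 2)

/-- `f` is doubly periodic with periods `b 0`, `b 1`, i.e. `f` is a function on the flat torus
`ℝ² / (ℤ b 0 + ℤ b 1)`. -/
def DoublyPeriodic (b : Module.Basis (Fin 2) ℝ Plane) {α : Type*} (f : Plane → α) : Prop :=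
  ∀ i : Fin 2, Function.Periodic f (b i)

/-- The area measure of the flat torus with periods `b 0`, `b 1`: Lebesgue measure restricted to
the half-open period parallelogram. -/
def torusMeasure (b : Module.Basis (Fin 2) ℝ Plane) : Measure Plane :=
  volume.restrict (ZSpan.fundamentalDomain b)

/-- Smooth test functions on the flat torus. -/
structure IsTorusTest (b : Module.Basis (Fin 2) ℝ Plane) (φ : Plane → ℝ) : Prop where
  periodic : DoublyPeriodic b φ
  smooth : ContDiff ℝ (⊤ : ℕ∞) φ

/-- `v ∈ W^{1,1}` of the flat torus, with weak gradient `g`. -/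
structure HasWeakGradient (b : Module.Basis (Fin 2) ℝ Plane) (v : Plane → ℝ)
    (g : Plane → Plane) : Prop where
  periodic : DoublyPeriodic b v
  periodic_grad : DoublyPeriodic b g
  integrable : Integrable v (torusMeasure b)
  integrable_grad : Integrable g (torusMeasure b)
  integral_eq : ∀ φ : Plane → ℝ, IsTorusTest b φ →
    ∫ x, v x • gradient φ x ∂(torusMeasure b) = - ∫ x, φ x • g x ∂(torusMeasure b)

/-- `v` is a weak solution, on the flat torus with periods `b 0`, `b 1`, of
`(1 - e^v) Δv - e^v |∇v|² + ε⁻² e^v (1 - e^v)² = 4π ∑ j, δ_{p j}`,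
whose first two terms are understood as `div ((1 - e^v) ∇v)`.
The points `p j` may repeat and are read modulo the periods.
No sign of `v` and no behaviour of `v` at the points `p j` is prescribed. -/
def IsVortexSolution (b : Module.Basis (Fin 2) ℝ Plane) {N : ℕ} (p : Fin N → Plane) (ε : ℝ)
    (v : Plane → ℝ) : Prop :=
  ∃ g : Plane → Plane, HasWeakGradient b v g ∧
    Integrable (fun x => (1 - Real.exp (v x)) • g x) (torusMeasure b) ∧
    Integrable (fun x => Real.exp (v x) * (1 - Real.exp (v x)) ^ 2) (torusMeasure b) ∧
    ∀ φ : Plane → ℝ, IsTorusTest b φ →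
      - ∫ x, inner ℝ ((1 - Real.exp (v x)) • g x) (gradient φ x) ∂(torusMeasure b)
        + 1 / ε ^ 2 * ∫ x, Real.exp (v x) * (1 - Real.exp (v x)) ^ 2 * φ x ∂(torusMeasure b)
        = 4 * Real.pi * ∑ j, φ (p j)

end

/-!
# Vortex equations on a flat torus in the limit of vanishing `ε`

Put `U = exp v - v`, so that `U ≥ 1` and `|v| ≤ U`. By the chain rule for weak derivatives
(`integral_exp_mul_fderiv`) the equation for `v` is a Poisson equation for `U`: in the sense of
distributions `ΔU = h - 4π ∑ j, δ_{p j}`, where `h = ε⁻² exp v (1 - exp v)² ≥ 0` has integral `4πN`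
(`SolvesPoisson`). Hence `ΔU` has total variation at most `8πN`, whatever `ε` is, and
`exp v (1 - exp v)²` tends to `0` in `L¹` as `ε → 0`. The alternative of the theorem is whether the
integrals of the functions `U_n` are bounded along a subsequence.

* If they tend to infinity, the Poincaré inequality `exists_poincare` bounds `U_n` minus its mean in
  `L¹`, so `U_n` divided by its mean tends to `1` in `L¹` and `U_n → ∞` almost everywhere along a
  subsequence. As `exp v_n (1 - exp v_n)²` tends to `0`, large positive values of `v_n` are excluded,
  and `v_n → -∞`.
* If they are bounded, `exists_integral_pow_le` bounds `U_n`, hence `v_n`, in every `Lᵐ`, because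
  `ΔU_n ≥ -4π ∑ j, δ_{p j}`. The function `exp t (1 - exp t)²` vanishes only at `0` and at `-∞`, so
  `|t|^m ≤ η |t|^(m+1) + η + K exp t (1 - exp t)²` with `K` depending on `η` and `m`
  (`exists_pow_le_nonlin`), and integration gives `v_n → 0` in `Lᵐ`.

Both estimates on `U` come from one identity. For a test function `ψ` the average
`Φ(t) = ∫ (R² - |y|²)₊ ψ(t y) dy` satisfies `Φ'(t) = (t / 4) ∫ (R² - |y|²)₊² Δψ(t y) dy`
(`hasDerivAt_scaleAvg`). It is applied to the correlation `z ↦ ∫ w(x) ψ(x + z) dx` of an integrable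
function `w` with `ψ`, which is again a test function and whose Laplacian at `z` is the
distributional Laplacian of `w` evaluated at the translate `ψ(· + z)`; thus neither a Green function
nor regularity of `w` is needed. The `L¹` norm of `w` is recovered by duality
(`integral_abs_le_of_forall_test`).
-/

open MeasureTheory Filter Topology
open scoped ENNReal Pointwise

variable {b : Module.Basis (Fin 2) ℝ Plane} {N : ℕ}

/-! ### Periodic functions and the area measure of the torus -/

lemma DoublyPeriodic.add_lattice {α : Type*} {f : Plane → α} (hf : DoublyPeriodic b f) {l : Plane}
    (hl : l ∈ Submodule.span ℤ (Set.range b)) (x : Plane) : f (x + l) = f x := by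
  suffices h : Function.Periodic f l from h x
  induction hl using Submodule.span_induction with
  | mem y hy => obtain ⟨i, rfl⟩ := hy; exact hf i
  | zero => intro x; simp
  | add y z _ _ hy hz => exact hy.add_period hz
  | smul n y _ hy => exact hy.zsmul n

lemma DoublyPeriodic.fract {α : Type*} {f : Plane → α} (hf : DoublyPeriodic b f) (x : Plane) :
    f (ZSpan.fract b x) = f x := by
  rw [ZSpan.fract_apply, sub_eq_add_neg]
  exact hf.add_lattice (neg_mem (ZSpan.floor b x).2) x

lemma DoublyPeriodic.comp {α β : Type*} {f : Plane → α} (hf : DoublyPeriodic b f) (F : α → β) :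
    DoublyPeriodic b (fun x => F (f x)) := fun i x => by simp only [hf i x]

lemma DoublyPeriodic.comp₂ {α β γ : Type*} {f : Plane → α} {g : Plane → β}
    (hf : DoublyPeriodic b f) (hg : DoublyPeriodic b g) (F : α → β → γ) :
    DoublyPeriodic b (fun x => F (f x) (g x)) := fun i x => by simp only [hf i x, hg i x]

lemma DoublyPeriodic.translate {α : Type*} {f : Plane → α} (hf : DoublyPeriodic b f) (y : Plane) :
    DoublyPeriodic b (fun x => f (x + y)) := fun i x => by
  simp only [add_right_comm x (b i) y, hf i (x + y)]

namespace TorusVortex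

/-- Lebesgue measure is invariant under the action of the period lattice. -/
instance : VAddInvariantMeasure (Submodule.span ℤ (Set.range b)) Plane volume :=
  inferInstanceAs (VAddInvariantMeasure (Submodule.span ℤ (Set.range b)).toAddSubgroup Plane volume)

lemma torusMeasure_univ_ne_top : torusMeasure b Set.univ ≠ ∞ := by
  rw [torusMeasure, Measure.restrict_apply_univ]
  exact (ZSpan.fundamentalDomain_isBounded b).measure_lt_top.ne

instance : IsFiniteMeasure (torusMeasure b) := ⟨torusMeasure_univ_ne_top.lt_top⟩

lemma torusMeasure_univ_ne_zero : torusMeasure b Set.univ ≠ 0 := by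
  rw [torusMeasure, Measure.restrict_apply_univ]
  exact ZSpan.measure_fundamentalDomain_ne_zero b

lemma torusMeasure_real_univ_pos : 0 < (torusMeasure b).real Set.univ :=
  ENNReal.toReal_pos torusMeasure_univ_ne_zero torusMeasure_univ_ne_top

lemma torusMeasure_absolutelyContinuous : torusMeasure b ≪ (volume : Measure Plane) :=
  Measure.restrict_le_self.absolutelyContinuous

/-- A periodic property that holds almost everywhere on the torus holds almost everywhere on the
plane. -/
lemma ae_volume_of_ae_torus {P : Plane → Prop} (hP : DoublyPeriodic b P)
    (h : ∀ᵐ x ∂(torusMeasure b), P x) : ∀ᵐ x, P x := by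
  rw [ae_iff]
  refine (ZSpan.isAddFundamentalDomain b volume).measure_zero_of_invariant _ ?_ ?_
  · intro l
    ext x
    rw [Set.mem_vadd_set_iff_neg_vadd_mem]
    simp only [Set.mem_ofPred_eq, Submodule.vadd_def, vadd_eq_add]
    rw [add_comm, hP.add_lattice (-l).2]
  · rw [ae_iff, torusMeasure, Measure.restrict_apply'
      (ZSpan.fundamentalDomain_measurableSet b)] at h
    exact h

lemma measurable_fract : Measurable (ZSpan.fract b) := by
  have h : ZSpan.fract b = fun x => x - ∑ i, (⌊b.repr x i⌋ : ℝ) • b i := by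
    ext1 x
    rw [ZSpan.fract_apply, ZSpan.floor]
    simp [Int.cast_smul_eq_zsmul]
  rw [h]
  have h2 : ∀ i, Measurable fun x => b.repr x i := fun i =>
    (b.coord i).continuous_of_finiteDimensional.measurable
  fun_prop

/-- A periodic function is determined by its restriction to a period cell, through the measurable
map `ZSpan.fract`. -/
lemma aestronglyMeasurable_volume {E : Type*} [TopologicalSpace E]
    [TopologicalSpace.PseudoMetrizableSpace E]
    {f : Plane → E} (hf : DoublyPeriodic b f)
    (h : AEStronglyMeasurable f (torusMeasure b)) : AEStronglyMeasurable f volume := by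
  refine ⟨fun x => h.mk f (ZSpan.fract b x),
    h.stronglyMeasurable_mk.comp_measurable measurable_fract, ?_⟩
  refine ae_volume_of_ae_torus (b := b) ?_ ?_
  · intro i x
    have : ZSpan.fract b (x + b i) = ZSpan.fract b x :=
      ZSpan.fract_add_ZSpan b x (Submodule.subset_span ⟨i, rfl⟩)
    simp only [this, hf i x]
  · filter_upwards [h.ae_eq_mk, ae_restrict_mem (ZSpan.fundamentalDomain_measurableSet b)]
      with x hx hxD
    rw [ZSpan.fract_eq_self.2 hxD, hx]

lemma isAddFundamentalDomain_preimage_add (b : Module.Basis (Fin 2) ℝ Plane) (y : Plane) :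
    IsAddFundamentalDomain (Submodule.span ℤ (Set.range b))
      ((fun x => x + y) ⁻¹' (ZSpan.fundamentalDomain b)) volume := by
  refine IsAddFundamentalDomain.mk'
    ((ZSpan.fundamentalDomain_measurableSet b).preimage (measurable_add_const y)).nullMeasurableSet
    fun x => ?_
  obtain ⟨l, hl, hu⟩ := ZSpan.exist_unique_vadd_mem_fundamentalDomain b (x + y)
  refine ⟨l, ?_, fun l' hl' => hu l' ?_⟩
  · simpa only [Set.mem_preimage, Submodule.vadd_def, vadd_eq_add, add_assoc] using hl
  · simpa only [Set.mem_preimage, Submodule.vadd_def, vadd_eq_add, add_assoc] using hl'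

/-- Integrals of periodic functions over the torus are translation invariant: a translate of a period
cell is again a fundamental domain. -/
lemma lintegral_torus_add {f : Plane → ℝ≥0∞} (hf : DoublyPeriodic b f) (y : Plane) :
    ∫⁻ x, f (x + y) ∂(torusMeasure b) = ∫⁻ x, f x ∂(torusMeasure b) := by
  have h1 := (measurePreserving_add_right (volume : Measure Plane) y).setLIntegral_comp_preimage_emb
    (measurableEmbedding_addRight y) f ((fun x => x + -y) ⁻¹' (ZSpan.fundamentalDomain b))
  have h2 := (isAddFundamentalDomain_preimage_add b (-y)).setLIntegral_eq
    (ZSpan.isAddFundamentalDomain b volume) f (fun l x => by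
      rw [Submodule.vadd_def, vadd_eq_add, add_comm, hf.add_lattice l.2])
  rw [torusMeasure, ← h2, ← h1]
  congr 2
  ext x; simp

lemma integral_torus_add {E : Type*} [NormedAddCommGroup E] [NormedSpace ℝ E] {f : Plane → E}
    (hf : DoublyPeriodic b f) (y : Plane) :
    ∫ x, f (x + y) ∂(torusMeasure b) = ∫ x, f x ∂(torusMeasure b) := by
  have h1 := (measurePreserving_add_right (volume : Measure Plane) y).setIntegral_preimage_emb
    (measurableEmbedding_addRight y) f ((fun x => x + -y) ⁻¹' (ZSpan.fundamentalDomain b))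
  have h2 := (isAddFundamentalDomain_preimage_add b (-y)).setIntegral_eq
    (ZSpan.isAddFundamentalDomain b volume) (f := f) (fun l x => by
      rw [Submodule.vadd_def, vadd_eq_add, add_comm, hf.add_lattice l.2])
  rw [torusMeasure, ← h2, ← h1]
  congr 2
  ext x; simp

lemma aestronglyMeasurable_torus_add {E : Type*} [TopologicalSpace E]
    [TopologicalSpace.PseudoMetrizableSpace E] {f : Plane → E} (hf : DoublyPeriodic b f)
    (h : AEStronglyMeasurable f (torusMeasure b)) (y : Plane) :
    AEStronglyMeasurable (fun x => f (x + y)) (torusMeasure b) :=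
  ((aestronglyMeasurable_volume hf h).comp_measurePreserving
    (measurePreserving_add_right (volume : Measure Plane) y)).mono_ac
      torusMeasure_absolutelyContinuous

lemma integrable_torus_add {E : Type*} [NormedAddCommGroup E] {f : Plane → E}
    (hf : DoublyPeriodic b f) (h : Integrable f (torusMeasure b)) (y : Plane) :
    Integrable (fun x => f (x + y)) (torusMeasure b) := by
  refine ⟨aestronglyMeasurable_torus_add hf h.1 y, ?_⟩
  exact (lintegral_torus_add (hf.comp (fun z => ‖z‖ₑ)) y).trans_lt h.2

/-- A ball of radius `R` meets only finitely many periods, so integrals of periodic functions over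
it are controlled by integrals over the torus, uniformly in the centre. -/
lemma exists_lintegral_ball_le (b : Module.Basis (Fin 2) ℝ Plane) (R : ℝ) :
    ∃ B : ℕ, ∀ f : Plane → ℝ≥0∞, DoublyPeriodic b f → ∀ z : Plane,
      ∫⁻ y in Metric.closedBall 0 R, f (z + y) ≤ B * ∫⁻ x, f x ∂(torusMeasure b) := by
  obtain ⟨R', hR'⟩ := (ZSpan.fundamentalDomain_isBounded b).subset_closedBall 0
  have hfin := ZSpan.setFinite_inter b
    (Metric.isBounded_closedBall (x := (0 : Plane)) (r := R + R'))
  refine ⟨hfin.toFinset.card, fun f hf z => ?_⟩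
  have hsub : Metric.closedBall (0 : Plane) R ⊆
      ⋃ l : hfin.toFinset, (fun x => x + -(l : Plane)) ⁻¹' (ZSpan.fundamentalDomain b) := by
    intro x hx
    simp only [Set.mem_iUnion]
    refine ⟨⟨ZSpan.floor b x, ?_⟩, ?_⟩
    · rw [Set.Finite.mem_toFinset]
      refine ⟨?_, (ZSpan.floor b x).2⟩
      have h1 := hR' (ZSpan.fract_mem_fundamentalDomain b x)
      rw [mem_closedBall_zero_iff] at *
      have : (ZSpan.floor b x : Plane) = x - ZSpan.fract b x := by
        rw [ZSpan.fract_apply]; abel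
      rw [this]
      exact (norm_sub_le _ _).trans (add_le_add hx h1)
    · have := ZSpan.fract_mem_fundamentalDomain b x
      rwa [ZSpan.fract_apply, sub_eq_add_neg] at this
  calc ∫⁻ y in Metric.closedBall 0 R, f (z + y)
      ≤ ∫⁻ y in ⋃ l : hfin.toFinset, (fun x => x + -(l : Plane)) ⁻¹' (ZSpan.fundamentalDomain b),
          f (z + y) := lintegral_mono_set hsub
    _ ≤ ∑' l : hfin.toFinset,
          ∫⁻ y in (fun x => x + -(l : Plane)) ⁻¹' (ZSpan.fundamentalDomain b), f (z + y) := by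
        exact lintegral_iUnion_le _ _
    _ = ∑' l : hfin.toFinset, ∫⁻ x, f x ∂(torusMeasure b) := by
        refine tsum_congr fun l => ?_
        have h2 := (isAddFundamentalDomain_preimage_add b (-(l : Plane))).setLIntegral_eq
          (ZSpan.isAddFundamentalDomain b volume) (fun y => f (z + y)) (fun l x => by
            rw [Submodule.vadd_def, vadd_eq_add, add_comm (l : Plane), ← add_assoc,
              hf.add_lattice l.2])
        rw [h2, ← lintegral_torus_add hf z, torusMeasure]
        simp only [add_comm z]
    _ = _ := by simp [tsum_fintype]

lemma integrableOn_ball {f : Plane → ℝ} (hf : DoublyPeriodic b f)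
    (h : Integrable f (torusMeasure b)) (R : ℝ) :
    IntegrableOn f (Metric.closedBall 0 R) := by
  refine ⟨(aestronglyMeasurable_volume hf h.1).restrict, ?_⟩
  obtain ⟨B, hB⟩ := exists_lintegral_ball_le b R
  have h1 := hB _ (hf.comp (fun z => ‖z‖ₑ)) 0
  simp only [zero_add] at h1
  exact h1.trans_lt (ENNReal.mul_lt_top (by simp) h.2)

lemma locallyIntegrable_volume {f : Plane → ℝ} (hf : DoublyPeriodic b f)
    (h : Integrable f (torusMeasure b)) : LocallyIntegrable f volume := fun x =>
  ⟨Metric.closedBall 0 (‖x‖ + 1), by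
    refine Filter.mem_of_superset (Metric.ball_mem_nhds x one_pos) fun y hy => ?_
    rw [mem_closedBall_zero_iff]
    have := norm_le_norm_add_norm_sub x y
    rw [Metric.mem_ball, dist_comm, dist_eq_norm] at hy
    linarith, integrableOn_ball hf h _⟩

lemma setIntegral_ball_le {R : ℝ} {B : ℕ} (hB : ∀ f : Plane → ℝ≥0∞, DoublyPeriodic b f →
      ∀ z : Plane, ∫⁻ y in Metric.closedBall 0 R, f (z + y) ≤ B * ∫⁻ x, f x ∂(torusMeasure b))
    {f : Plane → ℝ} (hf : DoublyPeriodic b f) (h : Integrable f (torusMeasure b))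
    (h0 : ∀ x, 0 ≤ f x) (z : Plane) :
    ∫ y in Metric.closedBall 0 R, f (z + y) ≤ B * ∫ x, f x ∂(torusMeasure b) := by
  have h1 := hB _ (hf.comp ENNReal.ofReal) z
  have hm : AEStronglyMeasurable (fun y => f (z + y)) volume :=
    (aestronglyMeasurable_volume hf h.1).comp_measurePreserving
      (measurePreserving_add_left (volume : Measure Plane) z)
  rw [integral_eq_lintegral_of_nonneg_ae (ae_of_all _ fun y => h0 _) hm.restrict,
    integral_eq_lintegral_of_nonneg_ae (ae_of_all _ fun y => h0 _) h.1]
  have h2 : ∫⁻ x, ENNReal.ofReal (f x) ∂(torusMeasure b) ≠ ∞ := by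
    exact ((hasFiniteIntegral_iff_ofReal (ae_of_all _ h0)).1 h.2).ne
  have := ENNReal.toReal_mono (ENNReal.mul_ne_top (by simp) h2) h1
  simpa using this

end TorusVortex

/-! ### Test functions -/

lemma IsTorusTest.translate {φ : Plane → ℝ} (hφ : IsTorusTest b φ) (y : Plane) :
    IsTorusTest b (fun x => φ (x + y)) :=
  ⟨hφ.periodic.translate y, hφ.smooth.comp (contDiff_id.add contDiff_const)⟩

lemma isTorusTest_const (c : ℝ) : IsTorusTest b (fun _ => c) := ⟨fun _ _ => rfl, contDiff_const⟩

lemma IsTorusTest.pow {φ : Plane → ℝ} (hφ : IsTorusTest b φ) (m : ℕ) :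
    IsTorusTest b (fun x => φ x ^ m) := ⟨hφ.periodic.comp (· ^ m), hφ.smooth.pow m⟩

lemma IsTorusTest.differentiable {φ : Plane → ℝ} (hφ : IsTorusTest b φ) : Differentiable ℝ φ :=
  hφ.smooth.differentiable (by simp)

lemma IsTorusTest.continuous {φ : Plane → ℝ} (hφ : IsTorusTest b φ) : Continuous φ :=
  hφ.smooth.continuous

lemma IsTorusTest.periodic_fderiv {φ : Plane → ℝ} (hφ : IsTorusTest b φ) :
    DoublyPeriodic b (fderiv ℝ φ) := fun i x => by
  rw [← fderiv_comp_add_right (b i)]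
  congr 1
  ext y
  exact hφ.periodic i y

lemma IsTorusTest.continuous_fderiv {φ : Plane → ℝ} (hφ : IsTorusTest b φ) :
    Continuous (fderiv ℝ φ) := hφ.smooth.continuous_fderiv (by simp)

lemma IsTorusTest.dirDeriv {φ : Plane → ℝ} (hφ : IsTorusTest b φ) (a : Plane) :
    IsTorusTest b (fun x => fderiv ℝ φ x a) :=
  ⟨hφ.periodic_fderiv.comp (fun A => A a),
    (hφ.smooth.fderiv_right (m := (⊤ : ℕ∞)) (by simp)).clm_apply contDiff_const⟩

lemma DoublyPeriodic.exists_norm_le {E : Type*} [SeminormedAddCommGroup E] {f : Plane → E}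
    (hf : DoublyPeriodic b f) (hc : Continuous f) : ∃ C, ∀ x, ‖f x‖ ≤ C := by
  obtain ⟨R, hR⟩ := (ZSpan.fundamentalDomain_isBounded b).subset_closedBall 0
  obtain ⟨C, hC⟩ := (isCompact_closedBall (0 : Plane) R).exists_bound_of_continuousOn
    hc.continuousOn
  refine ⟨C, fun x => ?_⟩
  rw [← hf.fract x]
  exact hC _ (hR (ZSpan.fract_mem_fundamentalDomain b x))

lemma IsTorusTest.exists_abs_le {φ : Plane → ℝ} (hφ : IsTorusTest b φ) : ∃ C, ∀ x, |φ x| ≤ C :=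
  hφ.periodic.exists_norm_le hφ.continuous

lemma IsTorusTest.exists_norm_fderiv_le {φ : Plane → ℝ} (hφ : IsTorusTest b φ) :
    ∃ C, ∀ x, ‖fderiv ℝ φ x‖ ≤ C :=
  hφ.periodic_fderiv.exists_norm_le hφ.continuous_fderiv

lemma IsTorusTest.integrable {φ : Plane → ℝ} (hφ : IsTorusTest b φ) :
    Integrable φ (torusMeasure b) := by
  obtain ⟨C, hC⟩ := hφ.exists_abs_le
  exact Integrable.of_bound hφ.continuous.aestronglyMeasurable C (ae_of_all _ hC)

lemma MeasureTheory.Integrable.mul_test {w φ : Plane → ℝ} (hw : Integrable w (torusMeasure b))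
    (hφ : IsTorusTest b φ) : Integrable (fun x => w x * φ x) (torusMeasure b) := by
  obtain ⟨C, hC⟩ := hφ.exists_abs_le
  exact hw.mul_bdd hφ.continuous.aestronglyMeasurable (ae_of_all _ hC)

namespace TorusVortex

/-! ### Approximation by test functions -/

/-- Mollification: a bounded measurable periodic function is an almost everywhere limit of test
functions with the same bounds. -/
lemma exists_test_tendsto_ae {ψ : Plane → ℝ} (hψ : DoublyPeriodic b ψ)
    (hm : AEStronglyMeasurable ψ (torusMeasure b)) {l u : ℝ} (hl : ∀ x, l ≤ ψ x)
    (hu : ∀ x, ψ x ≤ u) :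
    ∃ φ : ℕ → Plane → ℝ, (∀ k, IsTorusTest b (φ k)) ∧ (∀ k x, l ≤ φ k x) ∧ (∀ k x, φ k x ≤ u) ∧
      ∀ᵐ x ∂(torusMeasure b), Tendsto (fun k => φ k x) atTop (𝓝 (ψ x)) := by
  have hmv := aestronglyMeasurable_volume hψ hm
  have hbd : ∀ x, ‖ψ x‖ ≤ max |l| |u| := fun x => abs_le_max_abs_abs (hl x) (hu x)
  have hloc : LocallyIntegrable ψ volume :=
    locallyIntegrable_volume hψ (Integrable.of_bound hm _ (ae_of_all _ hbd))
  let ρ : ℕ → ContDiffBump (0 : Plane) := fun k =>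
    ⟨1 / (k + 1) / 2, 1 / (k + 1), by positivity, by
      have : (0 : ℝ) < 1 / (k + 1) := by positivity
      linarith⟩
  have hint : ∀ k x, Integrable (fun t => (ρ k).normed volume t * ψ (x - t)) volume := by
    intro k x
    refine ((ρ k).integrable_normed (μ := volume)).mul_bdd (c := max |l| |u|) ?_
      (ae_of_all _ fun t => hbd _)
    exact hmv.comp_quasiMeasurePreserving
      (quasiMeasurePreserving_sub_left (volume : Measure Plane) x)
  refine ⟨fun k => MeasureTheory.convolution ((ρ k).normed volume) ψ
    (ContinuousLinearMap.lsmul ℝ ℝ) volume, fun k => ⟨fun i x => ?_, ?_⟩, fun k x => ?_,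
    fun k x => ?_, ?_⟩
  · simp only [convolution]
    congr 1
    ext t
    rw [show x + b i - t = x - t + b i by abel, hψ i]
  · exact (ρ k).hasCompactSupport_normed.contDiff_convolution_left _ (ρ k).contDiff_normed hloc
  · simp only [convolution, ContinuousLinearMap.lsmul_apply, smul_eq_mul]
    calc l = ∫ t, (ρ k).normed volume t * l := by
          rw [integral_mul_const, (ρ k).integral_normed, one_mul]
      _ ≤ _ := integral_mono ((ρ k).integrable_normed.mul_const l) (hint k x) fun t =>
          mul_le_mul_of_nonneg_left (hl _) ((ρ k).nonneg_normed t)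
  · simp only [convolution, ContinuousLinearMap.lsmul_apply, smul_eq_mul]
    calc _ ≤ ∫ t, (ρ k).normed volume t * u :=
          integral_mono (hint k x) ((ρ k).integrable_normed.mul_const u) fun t =>
          mul_le_mul_of_nonneg_left (hu _) ((ρ k).nonneg_normed t)
      _ = u := by rw [integral_mul_const, (ρ k).integral_normed, one_mul]
  · refine torusMeasure_absolutelyContinuous.ae_le ?_
    refine ContDiffBump.ae_convolution_tendsto_right_of_locallyIntegrable (K := 2) ?_ ?_ hloc
    · exact tendsto_one_div_add_atTop_nhds_zero_nat
    · exact Eventually.of_forall fun k => by simp only [ρ]; linarith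

/-- The `L¹` norm on the torus is computed by testing against test functions bounded by `1`. -/
lemma integral_abs_le_of_forall_test {w : Plane → ℝ} (hw : DoublyPeriodic b w)
    (hi : Integrable w (torusMeasure b)) {B : ℝ}
    (h : ∀ φ, IsTorusTest b φ → (∀ x, |φ x| ≤ 1) → ∫ x, w x * φ x ∂(torusMeasure b) ≤ B) :
    ∫ x, |w x| ∂(torusMeasure b) ≤ B := by
  -- the optimal multiplier is the sign `w / |w|`, with value `0` where `w` vanishes
  have hsgn : ∀ x, |w x / (|w x|)| ≤ 1 := fun x => by
    rw [abs_div, abs_abs]; exact div_self_le_one _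
  obtain ⟨φ, hφ, hl, hu, hlim⟩ := exists_test_tendsto_ae (ψ := fun x => w x / |w x|)
    (hw.comp fun t => t / |t|)
    (hi.aemeasurable.div hi.abs.aemeasurable).aestronglyMeasurable (l := -1) (u := 1)
    (fun x => (abs_le.1 (hsgn x)).1) (fun x => (abs_le.1 (hsgn x)).2)
  refine le_of_tendsto (f := fun k => ∫ x, w x * φ k x ∂(torusMeasure b)) (x := atTop) ?_
    (Eventually.of_forall fun k => h (φ k) (hφ k) fun x => abs_le.2 ⟨hl k x, hu k x⟩)
  refine tendsto_integral_of_dominated_convergence (fun x => |w x|)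
    (fun k => (hi.mul_test (hφ k)).1) hi.abs (fun k => ae_of_all _ fun x => ?_) ?_
  · rw [Real.norm_eq_abs, abs_mul]
    exact mul_le_of_le_one_right (abs_nonneg _) (abs_le.2 ⟨hl k x, hu k x⟩)
  · filter_upwards [hlim] with x hx
    have : |w x| = w x * (w x / |w x|) := by
      rcases eq_or_ne (w x) 0 with h0 | h0
      · simp [h0]
      · rw [mul_div_assoc', eq_div_iff (abs_ne_zero.2 h0), abs_mul_abs_self]
    rw [this]
    exact hx.const_mul _

/-- Test functions are dense in `L¹` of the torus. -/
lemma exists_test_integral_sub_le {w : Plane → ℝ} (hw : DoublyPeriodic b w)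
    (hi : Integrable w (torusMeasure b)) {η : ℝ} (hη : 0 < η) :
    ∃ φ, IsTorusTest b φ ∧ ∫ x, |w x - φ x| ∂(torusMeasure b) < η := by
  -- truncation at height `K`, then mollification
  let c : ℕ → Plane → ℝ := fun K x => max (-(K : ℝ)) (min K (w x))
  have hcm : ∀ K, AEStronglyMeasurable (c K) (torusMeasure b) := fun K =>
    (aemeasurable_const.max (aemeasurable_const.min hi.aemeasurable)).aestronglyMeasurable
  have hc1 : Tendsto (fun K => ∫ x, |w x - c K x| ∂(torusMeasure b)) atTop (𝓝 0) := by
    rw [← integral_zero Plane ℝ (μ := torusMeasure b)]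
    refine tendsto_integral_of_dominated_convergence (fun x => |w x|)
      (fun K => (hi.1.sub (hcm K)).norm) hi.abs (fun K => ae_of_all _ fun x => ?_)
      (ae_of_all _ fun x => ?_)
    · rw [Real.norm_eq_abs, abs_abs]
      have hK : (0 : ℝ) ≤ K := Nat.cast_nonneg K
      simp only [c]
      rcases le_total (w x) K with h1 | h1
      · rw [min_eq_right h1]
        rcases le_total (-(K : ℝ)) (w x) with h2 | h2
        · rw [max_eq_right h2]; simp
        · rw [max_eq_left h2, abs_of_nonpos (by linarith), abs_of_nonpos (by linarith)]; linarith
      · rw [min_eq_left h1, max_eq_right (by linarith), abs_of_nonneg (by linarith),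
          abs_of_nonneg (by linarith)]
        linarith
    · refine tendsto_const_nhds.congr' ?_
      filter_upwards [eventually_ge_atTop ⌈|w x|⌉₊] with K hK
      have h1 := abs_le.1 (Nat.ceil_le.1 hK)
      simp only [c]
      rw [min_eq_right h1.2, max_eq_right h1.1, sub_self, abs_zero]
  obtain ⟨K, hK⟩ := (hc1.eventually (gt_mem_nhds (half_pos hη))).exists
  have hcl : ∀ x, -(K : ℝ) ≤ c K x := fun x => le_max_left _ _
  have hcu : ∀ x, c K x ≤ K := fun x =>
    max_le (by have := Nat.cast_nonneg (α := ℝ) K; linarith) (min_le_left _ _)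
  have hci : Integrable (c K) (torusMeasure b) :=
    Integrable.of_bound (hcm K) K (ae_of_all _ fun x => abs_le.2 ⟨hcl x, hcu x⟩)
  obtain ⟨φ, hφ, hl, hu, hlim⟩ := exists_test_tendsto_ae
    (hw.comp fun t => max (-(K : ℝ)) (min K t)) (hcm K) hcl hcu
  have h2 : Tendsto (fun k => ∫ x, |c K x - φ k x| ∂(torusMeasure b)) atTop (𝓝 0) := by
    rw [← integral_zero Plane ℝ (μ := torusMeasure b)]
    refine tendsto_integral_of_dominated_convergence (fun x => 2 * K)
      (fun k => (hci.sub (hφ k).integrable).1.norm) (integrable_const _)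
      (fun k => ae_of_all _ fun x => ?_) ?_
    · rw [Real.norm_eq_abs, abs_abs, abs_le]
      constructor <;> linarith [hcl x, hcu x, hl k x, hu k x]
    · filter_upwards [hlim] with x hx
      simpa [c] using (hx.const_sub (c K x)).abs
  obtain ⟨k, hk⟩ := (h2.eventually (gt_mem_nhds (half_pos hη))).exists
  refine ⟨φ k, hφ k, ?_⟩
  calc ∫ x, |w x - φ k x| ∂(torusMeasure b)
      ≤ ∫ x, (|w x - c K x| + |c K x - φ k x|) ∂(torusMeasure b) :=
        integral_mono (hi.sub (hφ k).integrable).abs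
          ((hi.sub hci).abs.add (hci.sub (hφ k).integrable).abs) fun x => abs_sub_le _ _ _
    _ = _ := integral_add (hi.sub hci).abs (hci.sub (hφ k).integrable).abs
    _ < η := by linarith

/-- Translations act continuously on `L¹` of the torus. -/
lemma exists_integral_translate_sub_le {w : Plane → ℝ} (hw : DoublyPeriodic b w)
    (hi : Integrable w (torusMeasure b)) {η : ℝ} (hη : 0 < η) :
    ∃ δ > 0, ∀ y : Plane, ‖y‖ < δ → ∫ x, |w (x + y) - w x| ∂(torusMeasure b) ≤ η := by
  obtain ⟨φ, hφ, hwφ⟩ := exists_test_integral_sub_le hw hi (η := η / 3) (by positivity)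
  obtain ⟨C, hC⟩ := hφ.exists_norm_fderiv_le
  have hC0 : 0 ≤ C := (norm_nonneg _).trans (hC 0)
  set V := (torusMeasure b).real Set.univ with hV
  have hV0 : 0 ≤ V := measureReal_nonneg
  refine ⟨η / 3 / (C * V + 1), by positivity, fun y hy => ?_⟩
  have hLip : ∀ x, |φ (x + y) - φ x| ≤ C * ‖y‖ := fun x => by
    have := convex_univ.norm_image_sub_le_of_norm_fderiv_le (𝕜 := ℝ) (f := φ)
      (fun z _ => hφ.differentiable z) (fun z _ => hC z) (Set.mem_univ x) (Set.mem_univ (x + y))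
    simpa using this
  have hi' := integrable_torus_add hw hi y
  have hφ' := (hφ.translate y).integrable
  have e1 : ∫ x, |w (x + y) - φ (x + y)| ∂(torusMeasure b) = ∫ x, |w x - φ x| ∂(torusMeasure b) :=
    integral_torus_add (hw.comp₂ hφ.periodic fun s t => |s - t|) y
  have e2 : ∫ x, |φ (x + y) - φ x| ∂(torusMeasure b) ≤ η / 3 := by
    calc _ ≤ ∫ x, C * ‖y‖ ∂(torusMeasure b) :=
          integral_mono (hφ'.sub hφ.integrable).abs (integrable_const _) hLip
      _ = ‖y‖ * (C * V) := by rw [integral_const, smul_eq_mul]; ring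
      _ ≤ ‖y‖ * (C * V + 1) := by gcongr; linarith
      _ ≤ η / 3 := by
        rw [lt_div_iff₀ (by positivity)] at hy
        exact hy.le
  have e3 : ∫ x, |φ x - w x| ∂(torusMeasure b) = ∫ x, |w x - φ x| ∂(torusMeasure b) := by
    simp only [abs_sub_comm]
  calc ∫ x, |w (x + y) - w x| ∂(torusMeasure b)
      ≤ ∫ x, (|w (x + y) - φ (x + y)| + (|φ (x + y) - φ x| + |φ x - w x|)) ∂(torusMeasure b) := by
        refine integral_mono (hi'.sub hi).abs ((hi'.sub hφ').abs.add
          ((hφ'.sub hφ.integrable).abs.add (hφ.integrable.sub hi).abs)) fun x => ?_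
        exact (abs_sub_le _ (φ (x + y)) _).trans (add_le_add_right (abs_sub_le _ _ _) _)
    _ = ∫ x, |w (x + y) - φ (x + y)| ∂(torusMeasure b) +
          (∫ x, |φ (x + y) - φ x| ∂(torusMeasure b) + ∫ x, |φ x - w x| ∂(torusMeasure b)) := by
        rw [integral_add, integral_add]
        exacts [(hφ'.sub hφ.integrable).abs, (hφ.integrable.sub hi).abs, (hi'.sub hφ').abs,
          ((hφ'.sub hφ.integrable).abs.add (hφ.integrable.sub hi).abs)]
    _ ≤ η := by rw [e1, e3]; linarith

/-! ### Correlations -/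

/-- The correlation `z ↦ ∫ w(x) ψ(x + z) dx` over the torus. -/
noncomputable def corr (b : Module.Basis (Fin 2) ℝ Plane) (w ψ : Plane → ℝ) (z : Plane) : ℝ :=
  ∫ x, w x * ψ (x + z) ∂(torusMeasure b)

lemma hasFDerivAt_corr {w ψ : Plane → ℝ} (hi : Integrable w (torusMeasure b))
    (hψ : IsTorusTest b ψ) (z : Plane) :
    HasFDerivAt (corr b w ψ) (∫ x, w x • fderiv ℝ ψ (x + z) ∂(torusMeasure b)) z := by
  obtain ⟨C, hC⟩ := hψ.exists_norm_fderiv_le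
  refine hasFDerivAt_integral_of_dominated_of_fderiv_le (s := Set.univ)
    (F' := fun z x => w x • fderiv ℝ ψ (x + z)) (bound := fun x => |w x| * C) univ_mem
    (Eventually.of_forall fun z => (hi.mul_test (hψ.translate z)).1)
    (hi.mul_test (hψ.translate z)) ?_ (ae_of_all _ fun x z _ => ?_) (hi.abs.mul_const C)
    (ae_of_all _ fun x z _ => ?_)
  · exact hi.1.smul (hψ.continuous_fderiv.comp (continuous_add_const z)).aestronglyMeasurable
  · rw [norm_smul]
    exact mul_le_mul_of_nonneg_left (hC _) (norm_nonneg _)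
  · have h1 : HasFDerivAt (fun z => ψ (x + z)) (fderiv ℝ ψ (x + z)) z :=
      (hasFDerivAt_comp_add_left x).2 (hψ.differentiable (x + z)).hasFDerivAt
    simpa using h1.const_mul (w x)

lemma fderiv_corr_apply {w ψ : Plane → ℝ} (hi : Integrable w (torusMeasure b))
    (hψ : IsTorusTest b ψ) (z a : Plane) :
    fderiv ℝ (corr b w ψ) z a = corr b w (fun x => fderiv ℝ ψ x a) z := by
  obtain ⟨C, hC⟩ := hψ.exists_norm_fderiv_le
  rw [(hasFDerivAt_corr hi hψ z).fderiv, corr, ContinuousLinearMap.integral_apply]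
  · rfl
  · refine Integrable.mono' (hi.abs.mul_const C) (hi.1.smul (hψ.continuous_fderiv.comp
      (continuous_add_const z)).aestronglyMeasurable) (ae_of_all _ fun x => ?_)
    rw [norm_smul]
    exact mul_le_mul_of_nonneg_left (hC _) (norm_nonneg _)

/-- The derivatives of a correlation fall on the smooth factor, so correlations with test functions
are test functions, however irregular `w` is. -/
lemma isTorusTest_corr {w ψ : Plane → ℝ} (hi : Integrable w (torusMeasure b))
    (hψ : IsTorusTest b ψ) : IsTorusTest b (corr b w ψ) := by
  refine ⟨fun i z => ?_, contDiff_infty.2 fun n => ?_⟩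
  · simp only [corr, ← add_assoc]
    congr 1
    ext x
    rw [hψ.periodic i]
  · induction n generalizing ψ with
    | zero =>
      exact contDiff_zero.2 (Differentiable.continuous (𝕜 := ℝ)
        fun z => (hasFDerivAt_corr hi hψ z).differentiableAt)
    | succ n ih =>
      rw [Nat.cast_succ, contDiff_succ_iff_fderiv_apply]
      refine ⟨fun z => (hasFDerivAt_corr hi hψ z).differentiableAt, by simp, fun a => ?_⟩
      rw [show (fun z => fderiv ℝ (corr b w ψ) z a) = corr b w (fun x => fderiv ℝ ψ x a) from
        funext fun z => fderiv_corr_apply hi hψ z a]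
      exact ih (hψ.dirDeriv a)

lemma integral_corr {w ψ : Plane → ℝ} (hi : Integrable w (torusMeasure b))
    (hψ : IsTorusTest b ψ) :
    ∫ z, corr b w ψ z ∂(torusMeasure b) =
      (∫ x, w x ∂(torusMeasure b)) * ∫ x, ψ x ∂(torusMeasure b) := by
  obtain ⟨C, hC⟩ := hψ.exists_abs_le
  simp only [corr]
  rw [integral_integral_swap]
  · rw [← integral_mul_const]
    congr 1
    ext x
    rw [integral_const_mul]
    congr 1
    simp only [add_comm x]
    exact integral_torus_add hψ.periodic x
  · refine Integrable.mul_bdd (c := C) ?_ ?_ (ae_of_all _ fun p => hC _)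
    · exact hi.comp_snd _
    · exact (hψ.continuous.comp (continuous_snd.add continuous_fst)).aestronglyMeasurable

/-! ### Difference quotients and the chain rule for weak derivatives -/

lemma integral_translate_mul {w φ : Plane → ℝ} (hw : DoublyPeriodic b w) (hφ : IsTorusTest b φ)
    (y : Plane) : ∫ x, w (x + y) * φ x ∂(torusMeasure b) = corr b w φ (-y) := by
  have h := integral_torus_add
    (hw.comp₂ (hφ.periodic.translate (-y)) fun s t => s * t) y
  rw [corr, ← h]
  simp

lemma hasDerivAt_corr_line {w φ : Plane → ℝ} (hi : Integrable w (torusMeasure b))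
    (hφ : IsTorusTest b φ) (a : Plane) (s : ℝ) :
    HasDerivAt (fun s : ℝ => corr b w φ (-(s • a)))
      (-corr b w (fun x => fderiv ℝ φ x a) (-(s • a))) s := by
  have h1 : HasDerivAt (fun s : ℝ => -(s • a)) (-a) s := by
    simpa using ((hasDerivAt_id s).smul_const a).fun_neg
  have h2 := (((isTorusTest_corr hi hφ).differentiable _).hasFDerivAt).comp_hasDerivAt s h1
  rwa [map_neg, fderiv_corr_apply hi hφ] at h2

/-- Difference quotients of `v` in the direction `a` converge in `L¹` to the weak derivative. -/
lemma exists_integral_diffQuotient_le {v γ : Plane → ℝ} {a : Plane} (hv : DoublyPeriodic b v)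
    (hvi : Integrable v (torusMeasure b)) (hγ : DoublyPeriodic b γ)
    (hγi : Integrable γ (torusMeasure b))
    (hw : ∀ φ, IsTorusTest b φ →
      ∫ x, v x * fderiv ℝ φ x a ∂(torusMeasure b) = -∫ x, γ x * φ x ∂(torusMeasure b))
    {η : ℝ} (hη : 0 < η) :
    ∃ δ > 0, ∀ s : ℝ, 0 < s → s < δ →
      ∫ x, |v (x + s • a) - v x - s * γ x| ∂(torusMeasure b) ≤ η * s := by
  obtain ⟨δ, hδ, hδη⟩ := exists_integral_translate_sub_le hγ hγi hη
  refine ⟨δ / (‖a‖ + 1), by positivity, fun s hs hsδ => ?_⟩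
  have hvs := integrable_torus_add hv hvi (s • a)
  refine integral_abs_le_of_forall_test (w := fun x => v (x + s • a) - v x - s * γ x) ?_ ((hvs.sub hvi).sub (hγi.const_mul s))
    fun φ hφ hφ1 => ?_
  · exact (((hv.translate (s • a)).comp₂ hv fun s t => s - t).comp₂ hγ fun p t => p - s * t)
  -- `J' r` tests the difference of `γ` and its translate by `r • a`, which is small in `L¹`
  set J : ℝ → ℝ := fun r => corr b v φ (-(r • a)) - r * ∫ x, γ x * φ x ∂(torusMeasure b) with hJ
  have hJ' : ∀ r, HasDerivAt J
      (∫ x, (γ (x + r • a) - γ x) * φ x ∂(torusMeasure b)) r := by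
    intro r
    have h1 := (hasDerivAt_corr_line hvi hφ a r).sub
      ((hasDerivAt_id r).mul_const (∫ x, γ x * φ x ∂(torusMeasure b)))
    refine h1.congr_deriv ?_
    have h2 := hw _ (hφ.translate (-(r • a)))
    simp only [fderiv_comp_add_right] at h2
    rw [corr, h2, neg_neg]
    simp only [sub_mul]
    rw [integral_sub ((integrable_torus_add hγ hγi _).mul_test hφ) (hγi.mul_test hφ),
      integral_translate_mul hγ hφ, corr, one_mul]
  have hbound : ∀ r ∈ Set.Ico 0 s,
      ‖∫ x, (γ (x + r • a) - γ x) * φ x ∂(torusMeasure b)‖ ≤ η := by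
    intro r hr
    have hlt : ‖r • a‖ < δ := by
      rw [norm_smul, Real.norm_eq_abs, abs_of_nonneg hr.1]
      rw [lt_div_iff₀ (by positivity)] at hsδ
      have := norm_nonneg a
      nlinarith [hr.1, hr.2]
    refine (norm_integral_le_integral_norm _).trans (le_trans ?_ (hδη _ hlt))
    have hi' := (integrable_torus_add hγ hγi (r • a)).sub hγi
    refine integral_mono (hi'.mul_test hφ).norm hi'.abs fun x => ?_
    simp only [norm_mul, Real.norm_eq_abs]
    exact mul_le_of_le_one_right (abs_nonneg _) (hφ1 x)
  have := norm_image_sub_le_of_norm_deriv_le_segment' (f := J)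
    (fun r _ => (hJ' r).hasDerivWithinAt) hbound s (Set.right_mem_Icc.2 hs.le)
  rw [sub_zero] at this
  refine le_trans (le_of_eq ?_) ((le_abs_self _).trans this)
  simp only [sub_mul, mul_assoc]
  have i1 : Integrable (fun x => v (x + s • a) * φ x - v x * φ x) (torusMeasure b) :=
    (hvs.mul_test hφ).sub (hvi.mul_test hφ)
  rw [integral_sub i1 ((hγi.mul_test hφ).const_mul s),
    integral_sub (hvs.mul_test hφ) (hvi.mul_test hφ), integral_const_mul,
    integral_translate_mul hv hφ]
  simp only [hJ, corr, zero_smul, neg_zero, add_zero, zero_mul, sub_zero]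
  ring

/-- Taylor remainder, bounded both linearly and quadratically in the increment; the bound by
`|g - ψ|` and `|ψ|` serves to split an integrable weight `g` into a small and a bounded part. -/
lemma abs_taylor_remainder_le {F F' : ℝ → ℝ} {L L' : ℝ} (hF : ∀ t, HasDerivAt F (F' t) t)
    (hL : ∀ t, |F' t| ≤ L) (hL' : ∀ s t, |F' s - F' t| ≤ L' * |s - t|) {K s : ℝ} (hs : 0 < s)
    (x y g ψ : ℝ) (hψ : |ψ| ≤ K) :
    |F y - F x - s * (F' x * g)| ≤
      3 * L * |y - x - s * g| + s * (2 * L * |g - ψ|) + s * (K * L' * |y - x|) := by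
  have hL0 : 0 ≤ L := (abs_nonneg _).trans (hL 0)
  have hL'0 : 0 ≤ L' := by simpa using (abs_nonneg _).trans (hL' 1 0)
  have hG : ∀ t, HasDerivAt (fun t => F t - F' x * t) (F' t - F' x) t := fun t => by
    simpa using (hF t).fun_sub ((hasDerivAt_id t).const_mul (F' x))
  have h1 : |F y - F x - F' x * (y - x)| ≤ 2 * L * |y - x| := by
    have := convex_univ.norm_image_sub_le_of_norm_hasDerivWithin_le
      (fun t _ => (hG t).hasDerivWithinAt) (C := 2 * L) (fun t _ => by
        rw [Real.norm_eq_abs, abs_le]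
        have h1 := abs_le.1 (hL t)
        have h2 := abs_le.1 (hL x)
        constructor <;> linarith) (Set.mem_univ x) (Set.mem_univ y)
    simp only [Real.norm_eq_abs] at this
    convert this using 2
    ring
  have h2 : |F y - F x - F' x * (y - x)| ≤ L' * |y - x| * |y - x| := by
    have := (convex_uIcc x y).norm_image_sub_le_of_norm_hasDerivWithin_le
      (fun t _ => (hG t).hasDerivWithinAt) (C := L' * |y - x|) (fun t ht => by
        refine (hL' t x).trans (mul_le_mul_of_nonneg_left ?_ hL'0)
        exact Set.abs_sub_left_of_mem_uIcc ht) Set.left_mem_uIcc Set.right_mem_uIcc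
    simp only [Real.norm_eq_abs] at this
    convert this using 2
    ring
  set D := |y - x - s * g|
  set A := |y - x| with hA
  have hA0 : 0 ≤ A := abs_nonneg _
  have hAD : A ≤ D + s * |g - ψ| + s * K := by
    have e : y - x = (y - x - s * g) + s * (g - ψ) + s * ψ := by ring
    rw [hA, e]
    refine (abs_add_three _ _ _).trans ?_
    rw [abs_mul, abs_mul, abs_of_pos hs]
    gcongr
  have h3 : |F y - F x - s * (F' x * g)| ≤ |F y - F x - F' x * (y - x)| + L * D := by
    have e : F y - F x - s * (F' x * g) =
        (F y - F x - F' x * (y - x)) + F' x * (y - x - s * g) := by ring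
    rw [e]
    refine (abs_add_le _ _).trans ?_
    rw [abs_mul]
    gcongr
    exact hL x
  have hK : 0 ≤ K := (abs_nonneg _).trans hψ
  have hD0 : 0 ≤ D := abs_nonneg _
  have hg0 : 0 ≤ |g - ψ| := abs_nonneg _
  have h4 : |F y - F x - F' x * (y - x)| ≤ 2 * L * D + s * (2 * L * |g - ψ|) + s * (K * L' * A) := by
    rcases le_total (2 * L) (L' * A) with hc | hc
    · calc _ ≤ 2 * L * A := h1
        _ ≤ 2 * L * (D + s * |g - ψ| + s * K) := by gcongr
        _ = 2 * L * D + s * (2 * L * |g - ψ|) + s * K * (2 * L) := by ring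
        _ ≤ 2 * L * D + s * (2 * L * |g - ψ|) + s * K * (L' * A) := by gcongr
        _ = _ := by ring
    · calc _ ≤ L' * A * A := h2
        _ ≤ L' * A * (D + s * |g - ψ| + s * K) := by gcongr
        _ = L' * A * (D + s * |g - ψ|) + s * (K * L' * A) := by ring
        _ ≤ 2 * L * (D + s * |g - ψ|) + s * (K * L' * A) := by gcongr
        _ = _ := by ring
  linarith

/-- Chain rule for weak directional derivatives and functions with bounded Lipschitz derivative. -/
lemma integral_comp_mul_fderiv {F F' : ℝ → ℝ} {L L' : ℝ} (hF : ∀ t, HasDerivAt F (F' t) t)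
    (hL : ∀ t, |F' t| ≤ L) (hL' : ∀ s t, |F' s - F' t| ≤ L' * |s - t|)
    {v γ : Plane → ℝ} {a : Plane} (hv : DoublyPeriodic b v)
    (hvi : Integrable v (torusMeasure b)) (hγ : DoublyPeriodic b γ)
    (hγi : Integrable γ (torusMeasure b))
    (hw : ∀ φ, IsTorusTest b φ →
      ∫ x, v x * fderiv ℝ φ x a ∂(torusMeasure b) = -∫ x, γ x * φ x ∂(torusMeasure b))
    (hFi : Integrable (fun x => F (v x)) (torusMeasure b)) {φ : Plane → ℝ}
    (hφ : IsTorusTest b φ) :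
    ∫ x, F (v x) * fderiv ℝ φ x a ∂(torusMeasure b) =
      -∫ x, F' (v x) * γ x * φ x ∂(torusMeasure b) := by
  have hL0 : 0 ≤ L := (abs_nonneg _).trans (hL 0)
  have hL'0 : 0 ≤ L' := by simpa using (abs_nonneg _).trans (hL' 1 0)
  have hF'c : Continuous F' := by
    have : LipschitzWith (Real.toNNReal L') F' := LipschitzWith.of_dist_le_mul fun s t => by
      rw [Real.coe_toNNReal _ hL'0, Real.dist_eq, Real.dist_eq]; exact hL' s t
    exact this.continuous
  have hFγi : Integrable (fun x => F' (v x) * γ x) (torusMeasure b) :=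
    hγi.bdd_mul (hF'c.comp_aestronglyMeasurable hvi.1) (ae_of_all _ fun x => hL _)
  obtain ⟨C, hC⟩ := hφ.exists_abs_le
  have hC0 : 0 ≤ C := (abs_nonneg _).trans (hC 0)
  set I := ∫ x, F' (v x) * γ x * φ x ∂(torusMeasure b)
  -- difference quotients of `F ∘ v` tested against `φ` are those of the smooth function `G` at `0`
  set G : ℝ → ℝ := fun s => corr b (fun x => F (v x)) φ (-(s • a)) with hG
  have hGd : HasDerivAt G (-∫ x, F (v x) * fderiv ℝ φ x a ∂(torusMeasure b)) 0 := by
    have := hasDerivAt_corr_line hFi hφ a 0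
    refine this.congr_deriv ?_
    simp [corr]
  suffices hmain : ∀ η > 0, |-(∫ x, F (v x) * fderiv ℝ φ x a ∂(torusMeasure b)) - I| ≤
      η * ((5 * L + 1) * C) by
    have h0 : |-(∫ x, F (v x) * fderiv ℝ φ x a ∂(torusMeasure b)) - I| ≤ 0 := by
      refine le_of_forall_pos_le_add fun ε hε => ?_
      have h1 := hmain (ε / ((5 * L + 1) * C + 1)) (by positivity)
      refine h1.trans ?_
      rw [zero_add, div_mul_eq_mul_div, div_le_iff₀ (by positivity)]
      nlinarith
    have := abs_nonpos_iff.1 h0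
    linarith
  intro η hη
  obtain ⟨ψ, hψ, hψη⟩ := exists_test_integral_sub_le hγ hγi hη
  obtain ⟨K, hK⟩ := hψ.exists_abs_le
  have hK0 : 0 ≤ K := (abs_nonneg _).trans (hK 0)
  obtain ⟨δ₁, hδ₁, h₁⟩ := exists_integral_diffQuotient_le hv hvi hγ hγi hw hη
  obtain ⟨δ₂, hδ₂, h₂⟩ := exists_integral_translate_sub_le hv hvi
    (η := η / (K * L' + 1)) (by positivity)
  have hslope := hGd.tendsto_slope_zero_right
  refine le_of_tendsto (hslope.sub_const I).abs ?_
  have hδ : 0 < min δ₁ (δ₂ / (‖a‖ + 1)) := by positivity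
  filter_upwards [Ioo_mem_nhdsGT hδ] with s hs
  obtain ⟨hs0, hsδ⟩ := hs
  have hs1 := h₁ s hs0 (hsδ.trans_le (min_le_left _ _))
  have hs2 := h₂ (s • a) (by
    have := hsδ.trans_le (min_le_right _ _)
    rw [lt_div_iff₀ (by positivity)] at this
    rw [norm_smul, Real.norm_eq_abs, abs_of_pos hs0]
    nlinarith)
  have hvs := integrable_torus_add hv hvi (s • a)
  have hFs := integrable_torus_add (hv.comp F) hFi (s • a)
  have i1 : Integrable (fun x => |v (x + s • a) - v x - s * γ x|) (torusMeasure b) :=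
    ((hvs.sub hvi).sub (hγi.const_mul s)).abs
  have i2 : Integrable (fun x => |γ x - ψ x|) (torusMeasure b) := (hγi.sub hψ.integrable).abs
  have i3 : Integrable (fun x => |v (x + s • a) - v x|) (torusMeasure b) := (hvs.sub hvi).abs
  have key : |∫ x, (F (v (x + s • a)) - F (v x) - s * (F' (v x) * γ x)) * φ x ∂(torusMeasure b)| ≤
      s * (η * ((5 * L + 1) * C)) := by
    refine abs_integral_le_integral_abs.trans ?_
    calc _ ≤ ∫ x, (3 * L * |v (x + s • a) - v x - s * γ x| + s * (2 * L * |γ x - ψ x|) +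
            s * (K * L' * |v (x + s • a) - v x|)) * C ∂(torusMeasure b) := by
          refine integral_mono (((hFs.sub hFi).sub (hFγi.const_mul s)).mul_test hφ).abs
            ((((i1.const_mul _).add ((i2.const_mul _).const_mul _)).add
              ((i3.const_mul _).const_mul _)).mul_const C) fun x => ?_
          simp only [abs_mul]
          have hx := abs_taylor_remainder_le hF hL hL' hs0 (v x) (v (x + s • a)) (γ x) (ψ x) (hK x)
          exact mul_le_mul hx (hC x) (abs_nonneg _) ((abs_nonneg _).trans hx)
      _ = (3 * L * ∫ x, |v (x + s • a) - v x - s * γ x| ∂(torusMeasure b) +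
            s * (2 * L * ∫ x, |γ x - ψ x| ∂(torusMeasure b)) +
            s * (K * L' * ∫ x, |v (x + s • a) - v x| ∂(torusMeasure b))) * C := by
          rw [integral_mul_const, integral_add, integral_add, integral_const_mul,
            integral_const_mul, integral_const_mul, integral_const_mul, integral_const_mul]
          exacts [i1.const_mul _, (i2.const_mul _).const_mul _,
            (i1.const_mul _).add ((i2.const_mul _).const_mul _), (i3.const_mul _).const_mul _]
      _ ≤ (3 * L * (η * s) + s * (2 * L * η) + s * (K * L' * (η / (K * L' + 1)))) * C := by
          gcongr
      _ ≤ (3 * L * (η * s) + s * (2 * L * η) + s * η) * C := by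
          gcongr
          rw [mul_div_assoc', div_le_iff₀ (by positivity)]
          nlinarith
      _ = _ := by ring
  have e : s⁻¹ • (G (0 + s) - G 0) - I =
      s⁻¹ * ∫ x, (F (v (x + s • a)) - F (v x) - s * (F' (v x) * γ x)) * φ x ∂(torusMeasure b) := by
    simp only [sub_mul]
    have i4 : Integrable (fun x => F (v (x + s • a)) * φ x - F (v x) * φ x) (torusMeasure b) :=
      (hFs.mul_test hφ).sub (hFi.mul_test hφ)
    rw [integral_sub i4,
      integral_sub (hFs.mul_test hφ) (hFi.mul_test hφ)]
    · simp only [mul_assoc s]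
      rw [integral_const_mul, integral_translate_mul (hv.comp F) hφ]
      simp only [hG, corr, zero_smul, neg_zero, add_zero, zero_add, smul_eq_mul]
      rw [mul_sub s⁻¹ _ (s * _), inv_mul_cancel_left₀ hs0.ne']
    · simpa only [mul_assoc] using (hFγi.mul_test hφ).const_mul s
  rw [e, abs_mul, abs_of_pos (inv_pos.2 hs0), inv_mul_le_iff₀ hs0]
  exact key

lemma norm_mul_le_norm_mul {s t : ℝ} (hs : 0 ≤ s) (hst : s ≤ t) (c : ℝ) : ‖s * c‖ ≤ ‖t * c‖ := by
  rw [norm_mul, norm_mul, Real.norm_of_nonneg hs, Real.norm_of_nonneg (hs.trans hst)]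
  exact mul_le_mul_of_nonneg_right hst (norm_nonneg c)

/-- Chain rule for `exp`, obtained from the truncations `k log (1 + eᵗ / k)`, which increase to
`eᵗ` and have bounded Lipschitz derivatives. -/
lemma integral_exp_mul_fderiv {v γ : Plane → ℝ} {a : Plane} (hv : DoublyPeriodic b v)
    (hvi : Integrable v (torusMeasure b)) (hγ : DoublyPeriodic b γ)
    (hγi : Integrable γ (torusMeasure b))
    (hw : ∀ φ, IsTorusTest b φ →
      ∫ x, v x * fderiv ℝ φ x a ∂(torusMeasure b) = -∫ x, γ x * φ x ∂(torusMeasure b))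
    (hei : Integrable (fun x => Real.exp (v x)) (torusMeasure b))
    (heγ : Integrable (fun x => Real.exp (v x) * γ x) (torusMeasure b)) {φ : Plane → ℝ}
    (hφ : IsTorusTest b φ) :
    ∫ x, Real.exp (v x) * fderiv ℝ φ x a ∂(torusMeasure b) =
      -∫ x, Real.exp (v x) * γ x * φ x ∂(torusMeasure b) := by
  let κ : ℕ → ℝ := fun n => n + 1
  have hκ : ∀ n, 0 < κ n := fun n => by positivity
  let F : ℕ → ℝ → ℝ := fun n t => κ n * Real.log (1 + Real.exp t / κ n)
  let F' : ℕ → ℝ → ℝ := fun n t => κ n * Real.exp t / (κ n + Real.exp t)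
  have hpos : ∀ n t, 0 < 1 + Real.exp t / κ n := fun n t =>
    add_pos one_pos (div_pos (Real.exp_pos t) (hκ n))
  have hpos' : ∀ n t, 0 < κ n + Real.exp t := fun n t => add_pos (hκ n) (Real.exp_pos t)
  have hF : ∀ n t, HasDerivAt (F n) (F' n t) t := by
    intro n t
    have h := ((((Real.hasDerivAt_exp t).div_const (κ n)).const_add 1).log
      (hpos n t).ne').const_mul (κ n)
    refine h.congr_deriv ?_
    have h1 := (hpos n t).ne'
    have h2 := (hpos' n t).ne'
    have h3 := (hκ n).ne'
    simp only [F']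
    field_simp
  have hF'0 : ∀ n t, 0 ≤ F' n t := fun n t =>
    div_nonneg (mul_nonneg (hκ n).le (Real.exp_pos t).le) (hpos' n t).le
  have hF'e : ∀ n t, F' n t ≤ Real.exp t := fun n t => by
    rw [div_le_iff₀ (hpos' n t)]
    nlinarith [Real.exp_pos t, hκ n]
  have hL : ∀ n t, |F' n t| ≤ κ n := fun n t => by
    rw [abs_of_nonneg (hF'0 n t), div_le_iff₀ (hpos' n t)]
    nlinarith [Real.exp_pos t, hκ n]
  have hF'' : ∀ n t, HasDerivAt (F' n) (κ n ^ 2 * Real.exp t / (κ n + Real.exp t) ^ 2) t := by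
    intro n t
    have h := ((Real.hasDerivAt_exp t).const_mul (κ n)).div
      ((Real.hasDerivAt_exp t).const_add (κ n)) (hpos' n t).ne'
    refine h.congr_deriv ?_
    ring
  have hL' : ∀ n s t, |F' n s - F' n t| ≤ κ n * |s - t| := by
    intro n s t
    refine convex_univ.norm_image_sub_le_of_norm_hasDerivWithin_le
      (fun t _ => (hF'' n t).hasDerivWithinAt) (fun t _ => ?_) (Set.mem_univ t) (Set.mem_univ s)
    have h0 := Real.exp_pos t
    have h1 := hκ n
    rw [Real.norm_eq_abs, abs_of_nonneg (by positivity), div_le_iff₀ (by positivity)]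
    nlinarith [mul_pos h1 h0, mul_pos h1 (mul_pos h1 h1), mul_pos h1 (mul_pos h0 h0),
      mul_pos h1 (mul_pos h1 h0)]
  have hF0 : ∀ n t, 0 ≤ F n t := fun n t =>
    mul_nonneg (hκ n).le (Real.log_nonneg (by
      have := div_pos (Real.exp_pos t) (hκ n)
      linarith))
  have hFe : ∀ n t, F n t ≤ Real.exp t := fun n t => by
    have := Real.log_le_sub_one_of_pos (hpos n t)
    calc F n t ≤ κ n * (Real.exp t / κ n) := mul_le_mul_of_nonneg_left (by linarith) (hκ n).le
      _ = Real.exp t := mul_div_cancel₀ _ (hκ n).ne'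
  have hκlim : Tendsto κ atTop atTop :=
    tendsto_atTop_add_const_right _ _ tendsto_natCast_atTop_atTop
  have hFlim : ∀ t, Tendsto (fun n => F n t) atTop (𝓝 (Real.exp t)) := fun t =>
    (Real.tendsto_mul_log_one_add_div_atTop (Real.exp t)).comp hκlim
  have hF'lim : ∀ t, Tendsto (fun n => F' n t) atTop (𝓝 (Real.exp t)) := by
    intro t
    have h1 : Tendsto (fun n => Real.exp t / (1 + Real.exp t / κ n)) atTop
        (𝓝 (Real.exp t / (1 + 0))) :=
      tendsto_const_nhds.div (tendsto_const_nhds.add (hκlim.const_div_atTop _)) (by simp)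
    rw [add_zero, div_one] at h1
    refine h1.congr fun n => ?_
    have h1 := (hpos n t).ne'
    have h2 := (hpos' n t).ne'
    have h3 := (hκ n).ne'
    simp only [F']
    field_simp
  have hFm : ∀ n, AEStronglyMeasurable (fun x => F n (v x)) (torusMeasure b) := fun n =>
    (continuous_iff_continuousAt.2 fun t => (hF n t).continuousAt).comp_aestronglyMeasurable hvi.1
  have hF'm : ∀ n, AEStronglyMeasurable (fun x => F' n (v x)) (torusMeasure b) := fun n =>
    (continuous_iff_continuousAt.2 fun t => (hF'' n t).continuousAt).comp_aestronglyMeasurable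
      hvi.1
  have hFi : ∀ n, Integrable (fun x => F n (v x)) (torusMeasure b) := fun n =>
    hei.mono' (hFm n) (ae_of_all _ fun x => by
      rw [Real.norm_eq_abs, abs_of_nonneg (hF0 n _)]; exact hFe n _)
  have heq := fun n => integral_comp_mul_fderiv (hF n) (hL n) (hL' n) hv hvi hγ hγi hw (hFi n) hφ
  have lim1 : Tendsto (fun n => ∫ x, F n (v x) * fderiv ℝ φ x a ∂(torusMeasure b)) atTop
      (𝓝 (∫ x, Real.exp (v x) * fderiv ℝ φ x a ∂(torusMeasure b))) := by
    refine tendsto_integral_of_dominated_convergence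
      (fun x => ‖Real.exp (v x) * fderiv ℝ φ x a‖)
      (fun n => ((hFi n).mul_test (hφ.dirDeriv a)).1) (hei.mul_test (hφ.dirDeriv a)).norm
      (fun n => ae_of_all _ fun x => ?_) (ae_of_all _ fun x => (hFlim _).mul_const _)
    exact norm_mul_le_norm_mul (hF0 n _) (hFe n _) _
  have lim2 : Tendsto (fun n => ∫ x, F' n (v x) * γ x * φ x ∂(torusMeasure b)) atTop
      (𝓝 (∫ x, Real.exp (v x) * γ x * φ x ∂(torusMeasure b))) := by
    refine tendsto_integral_of_dominated_convergence
      (fun x => ‖Real.exp (v x) * γ x * φ x‖)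
      (fun n => ((hF'm n).mul hγi.1).mul hφ.continuous.aestronglyMeasurable)
      (heγ.mul_test hφ).norm
      (fun n => ae_of_all _ fun x => ?_)
      (ae_of_all _ fun x => ((hF'lim _).mul_const _).mul_const _)
    rw [mul_assoc, mul_assoc]
    exact norm_mul_le_norm_mul (hF'0 n _) (hF'e n _) _
  refine tendsto_nhds_unique lim1 (lim2.neg.congr fun n => (heq n).symm)

/-! ### The Laplacian of test functions -/

lemma clm_apply_eq_sum (A : Plane →L[ℝ] ℝ) (y : Plane) :
    A y = ∑ i, y i * A (EuclideanSpace.single i 1) := by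
  have hy : y = ∑ i, y i • EuclideanSpace.single i (1 : ℝ) := by
    ext j
    fin_cases j <;> simp
  conv_lhs => rw [hy]
  rw [map_sum]
  simp

/-- The Laplacian `∂₁∂₁φ + ∂₂∂₂φ`. -/
noncomputable def lap (φ : Plane → ℝ) (x : Plane) : ℝ :=
  ∑ i : Fin 2, fderiv ℝ (fun z => fderiv ℝ φ z (EuclideanSpace.single i 1)) x
    (EuclideanSpace.single i 1)

lemma isTorusTest_lap {φ : Plane → ℝ} (hφ : IsTorusTest b φ) : IsTorusTest b (lap φ) := by
  refine ⟨fun i x => ?_, ContDiff.sum fun i _ => ((hφ.dirDeriv _).dirDeriv _).smooth⟩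
  simp only [lap]
  exact Finset.sum_congr rfl fun j _ => ((hφ.dirDeriv _).dirDeriv _).periodic i x

lemma lap_translate (φ : Plane → ℝ) (y x : Plane) :
    lap (fun x => φ (x + y)) x = lap φ (x + y) := by
  simp only [lap, fderiv_comp_add_right]
  refine Finset.sum_congr rfl fun i _ => ?_
  rw [fderiv_comp_add_right (f := fun z => fderiv ℝ φ z (EuclideanSpace.single i 1)) y]

lemma lap_corr {w ψ : Plane → ℝ} (hi : Integrable w (torusMeasure b)) (hψ : IsTorusTest b ψ)
    (z : Plane) :
    lap (corr b w ψ) z = ∫ x, w x * lap (fun x => ψ (x + z)) x ∂(torusMeasure b) := by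
  simp only [lap_translate]
  simp only [lap, fderiv_corr_apply hi hψ, Finset.mul_sum]
  rw [integral_finsetSum]
  · refine Finset.sum_congr rfl fun i _ => ?_
    rw [show (fun z => corr b w (fun x => fderiv ℝ ψ x (EuclideanSpace.single i 1)) z) =
      corr b w (fun x => fderiv ℝ ψ x (EuclideanSpace.single i 1)) from rfl,
      fderiv_corr_apply hi (hψ.dirDeriv _), corr]
  · exact fun i _ => hi.mul_test (((hψ.dirDeriv _).dirDeriv _).translate z)

/-! ### A radial averaging kernel -/

/-- The averaging kernel `(R² - |y|²)₊`. -/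
noncomputable def chi (R : ℝ) (y : Plane) : ℝ := max 0 (R ^ 2 - ‖y‖ ^ 2)

/-- The potential `(R² - |y|²)₊² / 4`, whose gradient is `-chi R y • y`. -/
noncomputable def pot (R : ℝ) (y : Plane) : ℝ := (max 0 (R ^ 2 - ‖y‖ ^ 2)) ^ 2 / 4

lemma hasDerivAt_max_zero_sq (s : ℝ) :
    HasDerivAt (fun s : ℝ => (max 0 s) ^ 2) (2 * max 0 s) s := by
  rcases lt_trichotomy s 0 with h | rfl | h
  · have : (fun s : ℝ => (max 0 s) ^ 2) =ᶠ[𝓝 s] fun _ => 0 := by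
      filter_upwards [gt_mem_nhds h] with t ht
      rw [max_eq_left ht.le]; simp
    rw [max_eq_left h.le, mul_zero]
    exact (hasDerivAt_const s (0 : ℝ)).congr_of_eventuallyEq this
  · rw [hasDerivAt_iff_isLittleO]
    refine Asymptotics.IsBigO.trans_isLittleO (g := fun t : ℝ => t ^ 2) ?_ ?_
    · refine Asymptotics.IsBigO.of_bound 1 (Eventually.of_forall fun t => ?_)
      simp only [max_self, mul_zero, smul_zero, sub_zero, ne_eq, OfNat.ofNat_ne_zero,
        not_false_eq_true, zero_pow, norm_pow, Real.norm_eq_abs, one_mul]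
      refine pow_le_pow_left₀ (abs_nonneg _) ?_ 2
      rw [abs_of_nonneg (le_max_left _ _)]
      exact max_le (abs_nonneg t) (le_abs_self t)
    · simpa using Asymptotics.isLittleO_pow_id (𝕜 := ℝ) one_lt_two
  · have : (fun s : ℝ => (max 0 s) ^ 2) =ᶠ[𝓝 s] fun s => s ^ 2 := by
      filter_upwards [lt_mem_nhds h] with t ht
      rw [max_eq_right ht.le]
    rw [max_eq_right h.le]
    simpa using (hasDerivAt_pow 2 s).congr_of_eventuallyEq this

lemma chi_nonneg (R : ℝ) (y : Plane) : 0 ≤ chi R y := le_max_left _ _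

lemma pot_nonneg (R : ℝ) (y : Plane) : 0 ≤ pot R y := by unfold pot; positivity

lemma continuous_chi (R : ℝ) : Continuous (chi R) := by unfold chi; fun_prop

lemma continuous_pot (R : ℝ) : Continuous (pot R) := by unfold pot; fun_prop

lemma chi_eq_zero {R : ℝ} (hR : 0 ≤ R) {y : Plane} (hy : y ∉ Metric.closedBall 0 R) :
    chi R y = 0 := by
  rw [mem_closedBall_zero_iff, not_le] at hy
  exact max_eq_left (by nlinarith)

lemma pot_eq_zero {R : ℝ} (hR : 0 ≤ R) {y : Plane} (hy : y ∉ Metric.closedBall 0 R) :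
    pot R y = 0 := by
  have := chi_eq_zero hR hy
  unfold chi at this
  simp [pot, this]

lemma hasCompactSupport_chi {R : ℝ} (hR : 0 ≤ R) : HasCompactSupport (chi R) :=
  HasCompactSupport.intro (isCompact_closedBall 0 R) fun _ hy => chi_eq_zero hR hy

lemma hasCompactSupport_pot {R : ℝ} (hR : 0 ≤ R) : HasCompactSupport (pot R) :=
  HasCompactSupport.intro (isCompact_closedBall 0 R) fun _ hy => pot_eq_zero hR hy

lemma integrable_chi_mul {R : ℝ} (hR : 0 ≤ R) {f : Plane → ℝ} (hf : Continuous f) :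
    Integrable (fun y => chi R y * f y) volume :=
  ((continuous_chi R).mul hf).integrable_of_hasCompactSupport (hasCompactSupport_chi hR).mul_right

lemma integrable_pot_mul {R : ℝ} (hR : 0 ≤ R) {f : Plane → ℝ} (hf : Continuous f) :
    Integrable (fun y => pot R y * f y) volume :=
  ((continuous_pot R).mul hf).integrable_of_hasCompactSupport (hasCompactSupport_pot hR).mul_right

lemma integrable_chi {R : ℝ} (hR : 0 ≤ R) : Integrable (chi R) volume :=
  (continuous_chi R).integrable_of_hasCompactSupport (hasCompactSupport_chi hR)

lemma integrable_pot {R : ℝ} (hR : 0 ≤ R) : Integrable (pot R) volume :=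
  (continuous_pot R).integrable_of_hasCompactSupport (hasCompactSupport_pot hR)

lemma integral_chi_pos {R : ℝ} (hR : 0 < R) : 0 < ∫ y, chi R y := by
  refine (continuous_chi R).integral_pos_of_hasCompactSupport_nonneg_nonzero
    (hasCompactSupport_chi hR.le) (chi_nonneg R) (x := 0) ?_
  have : 0 < R ^ 2 := by positivity
  simp [chi, hR.ne']

lemma hasFDerivAt_pot (R : ℝ) (y : Plane) :
    HasFDerivAt (pot R) (-(chi R y) • innerSL ℝ y) y := by
  have h1 : HasFDerivAt (fun y : Plane => R ^ 2 - ‖y‖ ^ 2) (-(2 • innerSL ℝ y)) y :=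
    ((hasStrictFDerivAt_norm_sq y).hasFDerivAt).const_sub (R ^ 2)
  have h2 := ((hasDerivAt_max_zero_sq (R ^ 2 - ‖y‖ ^ 2)).comp_hasFDerivAt y h1).mul_const
    (1 / 4 : ℝ)
  refine (h2.congr_fderiv ?_).congr_of_eventuallyEq (Eventually.of_forall fun z => ?_)
  · ext z
    simp [chi]
    ring
  · simp [pot, div_eq_mul_inv]

/-- Averages of `ψ` at scale `t` against the kernel `chi`. -/
noncomputable def scaleAvg (R : ℝ) (ψ : Plane → ℝ) (t : ℝ) : ℝ := ∫ y, chi R y * ψ (t • y)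

/-- The derivative of the average in the scale is an average of the Laplacian: the kernel times `y`
is a gradient, so the derivative of `ψ (t • y)` can be integrated by parts once more. -/
lemma hasDerivAt_scaleAvg {R : ℝ} (hR : 0 ≤ R) {ψ : Plane → ℝ} (hψ : IsTorusTest b ψ) (t : ℝ) :
    HasDerivAt (scaleAvg R ψ) (t * ∫ y, pot R y * lap ψ (t • y)) t := by
  obtain ⟨C, hC⟩ := hψ.exists_norm_fderiv_le
  have hcont : ∀ (t : ℝ) {f : Plane → ℝ}, Continuous f → Continuous fun y : Plane => f (t • y) :=
    fun t f hf => hf.comp (continuous_const_smul t)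
  have hcd : ∀ t : ℝ, Continuous fun y => fderiv ℝ ψ (t • y) y := fun t =>
    (hψ.continuous_fderiv.comp (continuous_const_smul t)).clm_apply continuous_id
  have h1 : HasDerivAt (scaleAvg R ψ) (∫ y, chi R y * fderiv ℝ ψ (t • y) y) t := by
    refine (hasDerivAt_integral_of_dominated_loc_of_deriv_le (μ := (volume : Measure Plane))
      (F := fun t y => chi R y * ψ (t • y)) (F' := fun t y => chi R y * fderiv ℝ ψ (t • y) y)
      (bound := fun y => chi R y * (C * ‖y‖)) (s := Set.univ) univ_mem
      (Eventually.of_forall fun t => ?_) ?_ ?_ (ae_of_all _ fun y t _ => ?_) ?_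
      (ae_of_all _ fun y t _ => ?_)).2
    · exact (integrable_chi_mul hR (hcont t hψ.continuous)).1
    · exact integrable_chi_mul hR (hcont t hψ.continuous)
    · exact (integrable_chi_mul hR (hcd t)).1
    · rw [norm_mul, Real.norm_of_nonneg (chi_nonneg R y)]
      refine mul_le_mul_of_nonneg_left ?_ (chi_nonneg R y)
      exact ((fderiv ℝ ψ (t • y)).le_opNorm y).trans
        (mul_le_mul_of_nonneg_right (hC _) (norm_nonneg y))
    · exact integrable_chi_mul hR (by fun_prop)
    · have h2 : HasDerivAt (fun t : ℝ => t • y) y t := by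
        simpa using (hasDerivAt_id t).smul_const y
      exact ((hψ.differentiable (t • y)).hasFDerivAt.comp_hasDerivAt t h2).const_mul _
  refine h1.congr_deriv ?_
  let e : Fin 2 → Plane := fun i => EuclideanSpace.single i 1
  have hexp : ∀ y : Plane, fderiv ℝ ψ (t • y) y = ∑ i, y i * fderiv ℝ ψ (t • y) (e i) :=
    fun y => clm_apply_eq_sum _ y
  have hdc : ∀ i, IsTorusTest b fun z => fderiv ℝ ψ z (e i) := fun i => hψ.dirDeriv (e i)
  have hfd : ∀ i y, fderiv ℝ (fun y => fderiv ℝ ψ (t • y) (e i)) y (e i) =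
      t * fderiv ℝ (fun z => fderiv ℝ ψ z (e i)) (t • y) (e i) := by
    intro i y
    have h := ((hdc i).differentiable (t • y)).hasFDerivAt.comp y
      ((hasFDerivAt_id (𝕜 := ℝ) y).const_smul t)
    refine (DFunLike.congr_fun h.fderiv (e i)).trans ?_
    simp
  have hibp : ∀ i, ∫ y : Plane, chi R y * (y i * fderiv ℝ ψ (t • y) (e i)) =
      t * ∫ y, pot R y * fderiv ℝ (fun z => fderiv ℝ ψ z (e i)) (t • y) (e i) := by
    intro i
    have hpd : ∀ y, fderiv ℝ (pot R) y (e i) = -(chi R y * y i) := fun y => by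
      rw [(hasFDerivAt_pot R y).fderiv]
      simp [e, EuclideanSpace.inner_single_right]
    have hcy : Continuous fun y : Plane => y i := by fun_prop
    have hg := hcont t (hdc i).continuous
    have hg' := hcont t ((hdc i).dirDeriv (e i)).continuous
    have := integral_mul_fderiv_eq_neg_fderiv_mul_of_integrable (μ := (volume : Measure Plane))
      (f := pot R) (g := fun y => fderiv ℝ ψ (t • y) (e i)) (v := e i) ?_ ?_ ?_
      (fun x _ => (hasFDerivAt_pot R x).differentiableAt)
      (fun x _ => ((hdc i).differentiable (t • x)).comp x
        (differentiableAt_id.const_smul t))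
    · simp only [hfd, hpd, neg_mul, integral_neg, neg_neg] at this
      rw [← integral_const_mul]
      simp only [mul_assoc] at this
      rw [← this]
      congr 1
      ext y
      ring
    · simp only [hpd, neg_mul, mul_assoc]
      exact (integrable_chi_mul hR (hcy.mul hg)).neg
    · simp only [hfd]
      exact integrable_pot_mul hR (continuous_const.mul hg')
    · exact integrable_pot_mul hR hg
  simp only [hexp, Finset.mul_sum, lap]
  rw [integral_finsetSum, integral_finsetSum, Finset.mul_sum]
  · exact Finset.sum_congr rfl fun i _ => hibp i
  · exact fun i _ => integrable_pot_mul hR (hcont t ((hdc i).dirDeriv (e i)).continuous)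
  · intro i _
    refine integrable_chi_mul hR (Continuous.mul (by fun_prop) (hcont t (hdc i).continuous))

lemma scaleAvg_zero (R : ℝ) (ψ : Plane → ℝ) : scaleAvg R ψ 0 = (∫ y, chi R y) * ψ 0 := by
  simp only [scaleAvg, zero_smul]
  exact integral_mul_const _ _

lemma scaleAvg_one (R : ℝ) (ψ : Plane → ℝ) : scaleAvg R ψ 1 = ∫ y, chi R y * ψ y := by
  simp only [scaleAvg, one_smul]

/-! ### A Poincaré inequality for measure-valued Laplacians -/

/-- A function of mean zero is controlled in `L¹` by the total variation of its Laplacian. Averages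
of a correlation with `w` at scale `0` and at scale `1` differ by at most a multiple of the total
variation, and, since the kernel is at least `1` on a whole period cell, averaging at scale `1`
contracts functions of mean zero. -/
lemma exists_poincare (b : Module.Basis (Fin 2) ℝ Plane) :
    ∃ C : ℝ, 0 ≤ C ∧ ∀ (w : Plane → ℝ) (M : ℝ), DoublyPeriodic b w →
      Integrable w (torusMeasure b) → ∫ x, w x ∂(torusMeasure b) = 0 →
      (∀ φ, IsTorusTest b φ → (∀ x, |φ x| ≤ 1) →
        |∫ x, w x * lap φ x ∂(torusMeasure b)| ≤ M) →
      ∫ x, |w x| ∂(torusMeasure b) ≤ C * M := by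
  obtain ⟨R₀, hR₀⟩ := (ZSpan.fundamentalDomain_isBounded b).subset_closedBall 0
  set R := |R₀| + 1 with hRdef
  have hR : 0 < R := by positivity
  set V := (torusMeasure b).real Set.univ with hV
  have hV0 : 0 < V := torusMeasure_real_univ_pos
  set c := ∫ y, chi R y with hc
  have hc0 : 0 < c := integral_chi_pos hR
  set Q := ∫ y, pot R y with hQ
  have hQ0 : 0 ≤ Q := integral_nonneg (pot_nonneg R)
  have hDm := ZSpan.fundamentalDomain_measurableSet b
  -- `R` is so large that the kernel is at least `1` on the period cell
  have hD : ∀ y, (ZSpan.fundamentalDomain b).indicator (fun _ => (1 : ℝ)) y ≤ chi R y := by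
    intro y
    refine Set.indicator_apply_le' (fun hy => ?_) fun _ => chi_nonneg R y
    refine le_max_of_le_right ?_
    have h1 := mem_closedBall_zero_iff.1 (hR₀ hy)
    have h2 := le_abs_self R₀
    have h3 := norm_nonneg y
    rw [hRdef]
    nlinarith
  have hDi : Integrable ((ZSpan.fundamentalDomain b).indicator (fun _ => (1 : ℝ))) volume := by
    rw [integrable_indicator_iff hDm]
    exact integrable_const (μ := torusMeasure b) (1 : ℝ)
  have hDint : ∫ y, (ZSpan.fundamentalDomain b).indicator (fun _ => (1 : ℝ)) y = V := by
    rw [integral_indicator hDm]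
    change ∫ _, (1 : ℝ) ∂(torusMeasure b) = V
    simp [hV]
  refine ⟨Q / V, by positivity, fun w M hw hi h0 hM => ?_⟩
  set S := ∫ x, |w x| ∂(torusMeasure b) with hS
  -- testing bounds `S` by `(1 - V / c) S` plus a multiple of `M`, and `V > 0`
  suffices h : S ≤ (M * Q + (c - V) * S) / c by
    rw [le_div_iff₀ hc0] at h
    rw [div_mul_eq_mul_div, le_div_iff₀ hV0]
    nlinarith
  refine integral_abs_le_of_forall_test hw hi fun ψ hψ hψ1 => ?_
  set I := corr b w ψ with hI
  have hIt : IsTorusTest b I := isTorusTest_corr hi hψ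
  have hIS : ∀ z, |I z| ≤ S := fun z => by
    refine abs_integral_le_integral_abs.trans ?_
    refine integral_mono (hi.mul_test (hψ.translate z)).abs hi.abs fun x => ?_
    simp only [abs_mul]
    exact mul_le_of_le_one_right (abs_nonneg _) (hψ1 _)
  have hlapI : ∀ z, |lap I z| ≤ M := fun z => by
    rw [hI, lap_corr hi hψ]
    exact hM _ (hψ.translate z) fun x => hψ1 _
  have hder : ∀ t ∈ Set.Ico (0 : ℝ) 1, ‖t * ∫ y, pot R y * lap I (t • y)‖ ≤ M * Q := by
    intro t ht
    have hM0 : 0 ≤ M := (abs_nonneg _).trans (hlapI 0)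
    have hcl : Continuous fun y : Plane => lap I (t • y) :=
      (isTorusTest_lap hIt).continuous.comp (continuous_const_smul t)
    have : |∫ y, pot R y * lap I (t • y)| ≤ M * Q := by
      refine abs_integral_le_integral_abs.trans ?_
      rw [hQ, ← integral_const_mul]
      refine integral_mono (integrable_pot_mul hR.le hcl).abs
        ((integrable_pot hR.le).const_mul M) fun y => ?_
      simp only [abs_mul, abs_of_nonneg (pot_nonneg R y)]
      rw [mul_comm]
      exact mul_le_mul_of_nonneg_right (hlapI _) (pot_nonneg R y)
    rw [Real.norm_eq_abs, abs_mul, abs_of_nonneg ht.1]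
    exact (mul_le_of_le_one_left (abs_nonneg _) ht.2.le).trans this
  have hdiff := norm_image_sub_le_of_norm_deriv_le_segment' (f := scaleAvg R I)
    (fun t _ => (hasDerivAt_scaleAvg hR.le hIt t).hasDerivWithinAt) hder 1
    (Set.right_mem_Icc.2 zero_le_one)
  rw [scaleAvg_zero, scaleAvg_one, sub_zero, mul_one, Real.norm_eq_abs] at hdiff
  -- the correlation has mean zero, so the indicator of the cell can be removed from the kernel
  have hcell : ∫ y, (ZSpan.fundamentalDomain b).indicator (fun _ => (1 : ℝ)) y * I y = 0 := by
    have : ∫ y, I y ∂(torusMeasure b) = 0 := by rw [hI, integral_corr hi hψ, h0, zero_mul]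
    rw [torusMeasure, ← integral_indicator hDm] at this
    rw [← this]
    congr 1
    ext y
    by_cases hy : y ∈ ZSpan.fundamentalDomain b <;> simp [hy]
  have hDI : Integrable (fun y => (ZSpan.fundamentalDomain b).indicator (fun _ => (1 : ℝ)) y * I y)
      volume := hDi.mul_bdd hIt.continuous.aestronglyMeasurable (ae_of_all _ hIS)
  have havg : |∫ y, chi R y * I y| ≤ (c - V) * S := by
    have e : ∫ y, chi R y * I y = ∫ y, (chi R y -
        (ZSpan.fundamentalDomain b).indicator (fun _ => (1 : ℝ)) y) * I y := by
      simp only [sub_mul]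
      rw [integral_sub (integrable_chi_mul hR.le hIt.continuous) hDI, hcell, sub_zero]
    rw [e, hc, ← hDint, ← integral_sub (integrable_chi hR.le) hDi, ← integral_mul_const]
    refine abs_integral_le_integral_abs.trans (integral_mono ?_
      (((integrable_chi hR.le).sub hDi).mul_const S) fun y => ?_)
    · simp only [sub_mul]
      exact ((integrable_chi_mul hR.le hIt.continuous).sub hDI).abs
    · simp only [abs_mul]
      rw [abs_of_nonneg (sub_nonneg.2 (hD y))]
      exact mul_le_mul_of_nonneg_left (hIS y) (sub_nonneg.2 (hD y))
  have hI0 : I 0 = ∫ x, w x * ψ x ∂(torusMeasure b) := by simp [hI, corr]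
  rw [← hI0, le_div_iff₀ hc0]
  have h1 := (abs_le.1 hdiff).1
  have h2 := (abs_le.1 havg).2
  linarith

/-! ### Bounds in `Lᵐ` from a one-sided bound on the Laplacian -/

/-- A form of Young's inequality. -/
lemma pow_le_mul_pow_succ_add {x η : ℝ} (hx : 0 ≤ x) (hη : 0 < η) (k : ℕ) :
    x ^ k ≤ η * x ^ (k + 1) + (η ^ k)⁻¹ := by
  rcases le_total (1 / η) x with h | h
  · have h1 : 1 ≤ η * x := by
      rw [div_le_iff₀ hη] at h
      linarith
    have h2 : x ^ k ≤ η * x * x ^ k := le_mul_of_one_le_left (by positivity) h1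
    have h3 : 0 ≤ (η ^ k)⁻¹ := by positivity
    rw [pow_succ]
    linarith
  · have h1 : x ^ k ≤ (1 / η) ^ k := pow_le_pow_left₀ hx h k
    have h2 : 0 ≤ η * x ^ (k + 1) := by positivity
    rw [one_div, inv_pow] at h1
    linarith

lemma setIntegral_ball_smul_le {B : ℕ} (hB : ∀ f : Plane → ℝ≥0∞, DoublyPeriodic b f →
      ∀ z : Plane, ∫⁻ y in Metric.closedBall 0 1, f (z + y) ≤ B * ∫⁻ x, f x ∂(torusMeasure b))
    {f : Plane → ℝ} (hf : IsTorusTest b f) (h0 : ∀ x, 0 ≤ f x) (z : Plane) {t : ℝ} (ht : 0 < t)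
    (ht1 : t ≤ 1) :
    ∫ y in Metric.closedBall 0 1, f (z + t • y) ≤ (t ^ 2)⁻¹ * (B * ∫ x, f x ∂(torusMeasure b)) := by
  have h1 := Measure.setIntegral_comp_smul_of_pos (volume : Measure Plane) (fun y => f (z + y))
    (Metric.closedBall 0 1) ht
  rw [h1, finrank_euclideanSpace_fin, smul_closedBall _ _ zero_le_one, smul_zero, mul_one,
    Real.norm_of_nonneg ht.le, smul_eq_mul]
  refine mul_le_mul_of_nonneg_left (le_trans ?_ (setIntegral_ball_le hB hf.periodic hf.integrable
    h0 z)) (by positivity)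
  have hc : Continuous fun y => f (z + y) := hf.continuous.comp (continuous_const_add z)
  exact setIntegral_mono_set (hc.continuousOn.integrableOn_compact (isCompact_closedBall 0 1))
    (ae_of_all _ fun y => h0 _)
    (Metric.closedBall_subset_closedBall ht1).eventuallyLE

lemma chi_one_le (y : Plane) : chi 1 y ≤ 1 := by
  refine max_le zero_le_one ?_
  have := sq_nonneg ‖y‖
  linarith

lemma pot_one_le (y : Plane) : pot 1 y ≤ 1 / 4 := by
  have h1 := chi_one_le y
  have h0 := chi_nonneg 1 y
  have h2 : chi 1 y ^ 2 ≤ 1 := pow_le_one₀ h0 h1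
  have h3 : pot 1 y = chi 1 y ^ 2 / 4 := rfl
  rw [h3]
  linarith

/-- An average against the compactly supported potential is controlled by a power integral over the
torus. The scale `t` is absorbed into the function before Young's inequality is applied, which
leaves the integrable singularity `t ^ (1 / k - 1)`. -/
lemma mul_integral_pot_pow_le {B : ℕ} (hB : ∀ f : Plane → ℝ≥0∞, DoublyPeriodic b f →
      ∀ z : Plane, ∫⁻ y in Metric.closedBall 0 1, f (z + y) ≤ B * ∫⁻ x, f x ∂(torusMeasure b))
    {s : Plane → ℝ} (hs : IsTorusTest b s) (h0 : ∀ x, 0 ≤ s x) {k : ℕ} (hk : 1 ≤ k) {η : ℝ}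
    (hη : 0 < η) (z : Plane) {t : ℝ} (ht : 0 < t) (ht1 : t ≤ 1) :
    t * ∫ y, pot 1 y * s (z + t • y) ^ k ≤
      (∫ y, pot 1 y) * (η ^ k)⁻¹ +
        η / 4 * (B * ∫ x, s x ^ (k + 1) ∂(torusMeasure b)) * t ^ ((1 : ℝ) / k - 1) := by
  have hk0 : (k : ℝ) ≠ 0 := by positivity
  -- Young's inequality for `τ s`, since `(τ s) ^ k = t s ^ k`
  set τ := t ^ ((1 : ℝ) / k) with hτ
  have hτ0 : 0 < τ := Real.rpow_pos_of_pos ht _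
  have hτk : τ ^ k = t := by
    rw [hτ, ← Real.rpow_natCast, ← Real.rpow_mul ht.le, one_div_mul_cancel hk0, Real.rpow_one]
  have hsc : Continuous fun y : Plane => s (z + t • y) :=
    hs.continuous.comp (by fun_prop)
  have hi1 : Integrable (fun y => pot 1 y * s (z + t • y) ^ k) volume :=
    integrable_pot_mul zero_le_one (hsc.pow k)
  have hi2 : Integrable (fun y => pot 1 y * s (z + t • y) ^ (k + 1)) volume :=
    integrable_pot_mul zero_le_one (hsc.pow (k + 1))
  have hpi := integrable_pot (R := 1) zero_le_one
  have e1 : ∫ y, pot 1 y * s (z + t • y) ^ (k + 1) ≤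
      1 / 4 * ((t ^ 2)⁻¹ * (B * ∫ x, s x ^ (k + 1) ∂(torusMeasure b))) := by
    refine le_trans ?_ (mul_le_mul_of_nonneg_left (setIntegral_ball_smul_le hB (hs.pow (k + 1))
      (fun x => pow_nonneg (h0 x) _) z ht ht1) (by norm_num))
    rw [← integral_const_mul, ← setIntegral_eq_integral_of_forall_compl_eq_zero
      (s := Metric.closedBall 0 1) fun y hy => by rw [pot_eq_zero zero_le_one hy, zero_mul]]
    refine integral_mono hi2.integrableOn (Integrable.const_mul
      ((hsc.pow (k + 1)).continuousOn.integrableOn_compact (isCompact_closedBall 0 1)) _)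
      fun y => ?_
    exact mul_le_mul_of_nonneg_right (pot_one_le y) (pow_nonneg (h0 _) _)
  have e2 : t * ∫ y, pot 1 y * s (z + t • y) ^ k ≤
      (∫ y, pot 1 y) * (η ^ k)⁻¹ + η * (t * τ) * ∫ y, pot 1 y * s (z + t • y) ^ (k + 1) := by
    rw [← integral_const_mul, ← integral_mul_const, ← integral_const_mul,
      ← integral_add (hpi.mul_const _) (hi2.const_mul _)]
    refine integral_mono (hi1.const_mul t) ((hpi.mul_const _).add (hi2.const_mul _)) fun y => ?_
    have hy := pow_le_mul_pow_succ_add (mul_nonneg hτ0.le (h0 (z + t • y))) hη k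
    rw [mul_pow, mul_pow, pow_succ τ, hτk] at hy
    have := mul_le_mul_of_nonneg_left hy (pot_nonneg 1 y)
    simp only
    linarith
  have e3 : t ^ ((1 : ℝ) / k - 1) = t * τ * (t ^ 2)⁻¹ := by
    rw [Real.rpow_sub ht, Real.rpow_one, ← hτ]
    field_simp
  refine e2.trans ?_
  rw [e3]
  have := mul_le_mul_of_nonneg_left e1 (by positivity : 0 ≤ η * (t * τ))
  linarith

/-- Testing against a power of a test function, for a nonnegative `U` whose Laplacian is bounded
below by negative point masses. -/
lemma integral_mul_pow_le {B : ℕ} (hB : ∀ f : Plane → ℝ≥0∞, DoublyPeriodic b f →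
      ∀ z : Plane, ∫⁻ y in Metric.closedBall 0 1, f (z + y) ≤ B * ∫⁻ x, f x ∂(torusMeasure b))
    {p : Fin N → Plane} {U : Plane → ℝ} (hUi : Integrable U (torusMeasure b)) (hU0 : ∀ x, 0 ≤ U x)
    (hU : ∀ φ, IsTorusTest b φ → (∀ x, 0 ≤ φ x) →
      -(4 * Real.pi * ∑ j, φ (p j)) ≤ ∫ x, U x * lap φ x ∂(torusMeasure b))
    {s : Plane → ℝ} (hs : IsTorusTest b s) (h0 : ∀ x, 0 ≤ s x) {k : ℕ} (hk : 1 ≤ k) {η : ℝ}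
    (hη : 0 < η) :
    (∫ y, chi 1 y) * ∫ x, U x * s x ^ k ∂(torusMeasure b) ≤
      B * ((∫ x, U x ∂(torusMeasure b)) * ∫ x, s x ^ k ∂(torusMeasure b)) +
      4 * Real.pi * N * ((∫ y, pot 1 y) * (η ^ k)⁻¹ +
        η / 4 * (B * ∫ x, s x ^ (k + 1) ∂(torusMeasure b)) * k) := by
  have hk0 : (0 : ℝ) < k := by positivity
  set Q := ∫ y, pot 1 y
  set S := ∫ x, s x ^ (k + 1) ∂(torusMeasure b)
  have hsk := hs.pow k
  set I := corr b U (fun x => s x ^ k) with hI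
  have hIt : IsTorusTest b I := isTorusTest_corr hUi hsk
  have hI0 : ∀ z, 0 ≤ I z := fun z =>
    integral_nonneg fun x => mul_nonneg (hU0 x) (pow_nonneg (h0 _) _)
  have hlap : ∀ z, -(4 * Real.pi * ∑ j, s (p j + z) ^ k) ≤ lap I z := fun z => by
    rw [hI, lap_corr hUi hsk]
    exact hU _ (hsk.translate z) fun x => pow_nonneg (h0 _) _
  -- `E` compensates for the decrease of the averages: its derivative is the bound of
  -- `mul_integral_pot_pow_le`, summed over the points `p j`
  set E : ℝ → ℝ := fun t =>
    4 * Real.pi * N * (Q * (η ^ k)⁻¹ * t + η / 4 * (B * S) * (k * t ^ ((1 : ℝ) / k))) with hE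
  have hEd : ∀ t, 0 < t → HasDerivAt E
      (4 * Real.pi * N * (Q * (η ^ k)⁻¹ + η / 4 * (B * S) * t ^ ((1 : ℝ) / k - 1))) t := by
    intro t ht
    have h1 := (Real.hasDerivAt_rpow_const (p := (1 : ℝ) / k) (Or.inl ht.ne')).const_mul (k : ℝ)
    have h2 := (((hasDerivAt_id t).const_mul (Q * (η ^ k)⁻¹)).add
      (h1.const_mul (η / 4 * (B * S)))).const_mul (4 * Real.pi * N)
    refine h2.congr_deriv ?_
    rw [← mul_assoc (k : ℝ), mul_one_div_cancel hk0.ne']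
    ring
  have hEc : Continuous E := by
    have : Continuous fun t : ℝ => t ^ ((1 : ℝ) / k) :=
      Real.continuous_rpow_const (by positivity)
    fun_prop
  have hmono : MonotoneOn (fun t => scaleAvg 1 I t + E t) (Set.Icc 0 1) := by
    refine monotoneOn_of_deriv_nonneg (convex_Icc 0 1) ?_ ?_ ?_
    · have : Continuous (scaleAvg 1 I) := continuous_iff_continuousAt.2 fun t =>
        (hasDerivAt_scaleAvg zero_le_one hIt t).continuousAt
      exact (this.add hEc).continuousOn
    · intro t ht
      rw [interior_Icc] at ht
      exact ((hasDerivAt_scaleAvg zero_le_one hIt t).add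
        (hEd t ht.1)).differentiableAt.differentiableWithinAt
    · intro t ht
      rw [interior_Icc] at ht
      obtain ⟨ht0, ht1⟩ := ht
      have hd := (hasDerivAt_scaleAvg zero_le_one hIt t).fun_add (hEd t ht0)
      rw [hd.deriv]
      have hcs : ∀ j, Continuous fun y : Plane => s (p j + t • y) ^ k := fun j =>
        hsk.continuous.comp (by fun_prop)
      have e1 : -(4 * Real.pi * ∑ j, ∫ y, pot 1 y * s (p j + t • y) ^ k) ≤
          ∫ y, pot 1 y * lap I (t • y) := by
        rw [← integral_finsetSum _ fun j _ => integrable_pot_mul zero_le_one (hcs j),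
          ← integral_const_mul, ← integral_neg]
        refine integral_mono (((integrable_finsetSum _ fun j _ =>
          integrable_pot_mul zero_le_one (hcs j)).const_mul _).neg)
          (integrable_pot_mul zero_le_one
            ((isTorusTest_lap hIt).continuous.comp (continuous_const_smul t))) fun y => ?_
        have := mul_le_mul_of_nonneg_left (hlap (t • y)) (pot_nonneg 1 y)
        refine le_trans (le_of_eq ?_) this
        simp only [← Finset.mul_sum]
        ring
      have e2 : ∑ j, t * ∫ y, pot 1 y * s (p j + t • y) ^ k ≤
          N * (Q * (η ^ k)⁻¹ + η / 4 * (B * S) * t ^ ((1 : ℝ) / k - 1)) := by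
        refine (Finset.sum_le_sum fun j _ =>
          mul_integral_pot_pow_le hB hs h0 hk hη (p j) ht0 ht1.le).trans ?_
        rw [Finset.sum_const, Finset.card_univ, Fintype.card_fin, nsmul_eq_mul]
      rw [← Finset.mul_sum] at e2
      have e3 := mul_le_mul_of_nonneg_left e1 ht0.le
      have e4 := mul_le_mul_of_nonneg_left e2 (by positivity : 0 ≤ 4 * Real.pi)
      linarith
  have h01 := hmono (Set.left_mem_Icc.2 zero_le_one) (Set.right_mem_Icc.2 zero_le_one) zero_le_one
  have hk1 : (1 : ℝ) / k ≠ 0 := by positivity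
  simp only [scaleAvg_zero, scaleAvg_one, hE, Real.zero_rpow hk1, Real.one_rpow, mul_zero,
    mul_one, add_zero] at h01
  have hI00 : I 0 = ∫ x, U x * s x ^ k ∂(torusMeasure b) := by simp [hI, corr]
  have hone : ∫ y, chi 1 y * I y ≤
      B * ((∫ x, U x ∂(torusMeasure b)) * ∫ x, s x ^ k ∂(torusMeasure b)) := by
    rw [← integral_corr hUi hsk]
    have h2 := setIntegral_ball_le hB hIt.periodic hIt.integrable hI0 0
    refine le_trans ?_ h2
    rw [← setIntegral_eq_integral_of_forall_compl_eq_zero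
      (s := Metric.closedBall 0 1) fun y hy => by rw [chi_eq_zero zero_le_one hy, zero_mul]]
    simp only [zero_add]
    refine integral_mono (integrable_chi_mul zero_le_one hIt.continuous).integrableOn
      (hIt.continuous.continuousOn.integrableOn_compact (isCompact_closedBall 0 1)) fun y => ?_
    exact mul_le_of_le_one_left (hI0 y) (chi_one_le y)
  rw [← hI00]
  linarith

/-- A nonnegative function on the torus whose Laplacian is bounded below by finitely many negative
point masses is bounded in every `Lᵐ`, in terms of its `L¹` norm. -/
lemma exists_integral_pow_le (b : Module.Basis (Fin 2) ℝ Plane) (p : Fin N → Plane) (A : ℝ)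
    {k : ℕ} (hk : 1 ≤ k) :
    ∃ C : ℝ, ∀ U : Plane → ℝ, DoublyPeriodic b U → Integrable U (torusMeasure b) →
      (∀ x, 0 ≤ U x) → ∫ x, U x ∂(torusMeasure b) ≤ A →
      (∀ φ, IsTorusTest b φ → (∀ x, 0 ≤ φ x) →
        -(4 * Real.pi * ∑ j, φ (p j)) ≤ ∫ x, U x * lap φ x ∂(torusMeasure b)) →
      Integrable (fun x => U x ^ (k + 1)) (torusMeasure b) ∧
        ∫ x, U x ^ (k + 1) ∂(torusMeasure b) ≤ C := by
  obtain ⟨B, hB⟩ := exists_lintegral_ball_le b 1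
  set c := ∫ y, chi 1 y with hc
  have hc0 : 0 < c := integral_chi_pos one_pos
  set Q := ∫ y, pot 1 y with hQ
  set V := (torusMeasure b).real Set.univ with hV
  -- `η` is so small that the terms with `∫ s ^ (k + 1)` add up to at most `c / 2` times it
  set C₁ := B * |A| + Real.pi * N * B * k with hC₁
  have hC₁0 : 0 ≤ C₁ := by positivity
  set η := c / (2 * C₁ + 1) with hη
  have hη0 : 0 < η := by positivity
  have hηC : η * C₁ ≤ c / 2 := by
    rw [hη, div_mul_eq_mul_div, div_le_div_iff₀ (by positivity) two_pos]
    nlinarith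
  set C₂ := B * |A| * ((η ^ k)⁻¹ * V) + 4 * Real.pi * N * (Q * (η ^ k)⁻¹) with hC₂
  refine ⟨C₂ / (c / 2), fun U hUp hUi hU0 hUA hU => ?_⟩
  have hA0 : 0 ≤ ∫ x, U x ∂(torusMeasure b) := integral_nonneg hU0
  have htest : ∀ s, IsTorusTest b s → (∀ x, 0 ≤ s x) →
      c * ∫ x, U x * s x ^ k ∂(torusMeasure b) ≤
        c / 2 * ∫ x, s x ^ (k + 1) ∂(torusMeasure b) + C₂ := by
    intro s hs h0
    have h1 := integral_mul_pow_le hB hUi hU0 hU hs h0 hk hη0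
    have hS0 : 0 ≤ ∫ x, s x ^ (k + 1) ∂(torusMeasure b) :=
      integral_nonneg fun x => pow_nonneg (h0 x) _
    have h2 : ∫ x, s x ^ k ∂(torusMeasure b) ≤
        η * ∫ x, s x ^ (k + 1) ∂(torusMeasure b) + (η ^ k)⁻¹ * V := by
      have : ∫ x, (η ^ k)⁻¹ ∂(torusMeasure b) = (η ^ k)⁻¹ * V := by
        rw [integral_const, smul_eq_mul, mul_comm]
      rw [← this, ← integral_const_mul, ← integral_add ((hs.pow _).integrable.const_mul _)
        (integrable_const _)]
      exact integral_mono (hs.pow _).integrable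
        (((hs.pow _).integrable.const_mul _).add (integrable_const _))
        fun x => pow_le_mul_pow_succ_add (h0 x) hη0 k
    have h3 : (∫ x, U x ∂(torusMeasure b)) * ∫ x, s x ^ k ∂(torusMeasure b) ≤
        |A| * (η * ∫ x, s x ^ (k + 1) ∂(torusMeasure b) + (η ^ k)⁻¹ * V) :=
      mul_le_mul (hUA.trans (le_abs_self A)) h2
        (integral_nonneg fun x => pow_nonneg (h0 x) _) (abs_nonneg A)
    have h4 := mul_le_mul_of_nonneg_left h3 (Nat.cast_nonneg (α := ℝ) B)
    have h5 := mul_le_mul_of_nonneg_right hηC hS0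
    rw [hC₁] at h5
    rw [hC₂]
    linarith
  -- choose `s → min U K` in `htest` and use `min U K ≤ U` on the left
  have htrunc : ∀ K : ℕ, ∫ x, (min (U x) K) ^ (k + 1) ∂(torusMeasure b) ≤ C₂ / (c / 2) := by
    intro K
    have hσ0 : ∀ x, 0 ≤ min (U x) (K : ℝ) := fun x => le_min (hU0 x) (Nat.cast_nonneg K)
    have hσK : ∀ x, min (U x) (K : ℝ) ≤ K := fun x => min_le_right _ _
    have hσm : AEStronglyMeasurable (fun x => min (U x) (K : ℝ)) (torusMeasure b) :=
      (hUi.aemeasurable.min aemeasurable_const).aestronglyMeasurable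
    obtain ⟨s, hs, hs0, hsK, hlim⟩ := exists_test_tendsto_ae
      (hUp.comp fun t => min t (K : ℝ)) hσm hσ0 hσK
    have l1 : Tendsto (fun i => ∫ x, U x * s i x ^ k ∂(torusMeasure b)) atTop
        (𝓝 (∫ x, U x * (min (U x) K) ^ k ∂(torusMeasure b))) := by
      refine tendsto_integral_of_dominated_convergence (fun x => U x * (K : ℝ) ^ k)
        (fun i => (hUi.mul_test ((hs i).pow k)).1) (hUi.mul_const _)
        (fun i => ae_of_all _ fun x => ?_) ?_
      · rw [Real.norm_of_nonneg (mul_nonneg (hU0 x) (pow_nonneg (hs0 i x) _))]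
        exact mul_le_mul_of_nonneg_left (pow_le_pow_left₀ (hs0 i x) (hsK i x) _) (hU0 x)
      · filter_upwards [hlim] with x hx
        exact (hx.pow k).const_mul _
    have l2 : Tendsto (fun i => ∫ x, s i x ^ (k + 1) ∂(torusMeasure b)) atTop
        (𝓝 (∫ x, (min (U x) K) ^ (k + 1) ∂(torusMeasure b))) := by
      refine tendsto_integral_of_dominated_convergence (fun x => (K : ℝ) ^ (k + 1))
        (fun i => ((hs i).pow _).integrable.1) (integrable_const _)
        (fun i => ae_of_all _ fun x => ?_) ?_
      · rw [Real.norm_of_nonneg (pow_nonneg (hs0 i x) _)]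
        exact pow_le_pow_left₀ (hs0 i x) (hsK i x) _
      · filter_upwards [hlim] with x hx
        exact hx.pow _
    have h1 := le_of_tendsto_of_tendsto' (l1.const_mul c) ((l2.const_mul (c / 2)).add_const C₂)
      fun i => htest (s i) (hs i) (hs0 i)
    have h2 : ∫ x, (min (U x) K) ^ (k + 1) ∂(torusMeasure b) ≤
        ∫ x, U x * (min (U x) K) ^ k ∂(torusMeasure b) := by
      refine integral_mono_of_nonneg (ae_of_all _ fun x => pow_nonneg (hσ0 x) _)
        (hUi.mul_bdd (c := (K : ℝ) ^ k) (hσm.pow k) (ae_of_all _ fun x => ?_))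
        (ae_of_all _ fun x => ?_)
      · rw [Real.norm_of_nonneg (pow_nonneg (hσ0 x) _)]
        exact pow_le_pow_left₀ (hσ0 x) (hσK x) _
      · simp only
        rw [pow_succ, mul_comm]
        exact mul_le_mul_of_nonneg_right (min_le_left _ _) (pow_nonneg (hσ0 x) _)
    have h3 := mul_le_mul_of_nonneg_left h2 hc0.le
    rw [le_div_iff₀ (by positivity)]
    linarith
  -- Fatou's lemma along the truncations
  have hm : AEStronglyMeasurable (fun x => U x ^ (k + 1)) (torusMeasure b) := hUi.1.pow _
  have hnn : ∀ x, 0 ≤ U x ^ (k + 1) := fun x => pow_nonneg (hU0 x) _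
  have hfatou : ∫⁻ x, ENNReal.ofReal (U x ^ (k + 1)) ∂(torusMeasure b) ≤
      ENNReal.ofReal (C₂ / (c / 2)) := by
    have hmK : ∀ K : ℕ, AEMeasurable
        (fun x => ENNReal.ofReal ((min (U x) (K : ℝ)) ^ (k + 1))) (torusMeasure b) := fun K =>
      ((hUi.aemeasurable.min aemeasurable_const).pow_const _).ennreal_ofReal
    calc ∫⁻ x, ENNReal.ofReal (U x ^ (k + 1)) ∂(torusMeasure b)
        = ∫⁻ x, liminf (fun K : ℕ => ENNReal.ofReal ((min (U x) (K : ℝ)) ^ (k + 1))) atTop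
            ∂(torusMeasure b) := by
          refine lintegral_congr fun x => ?_
          refine (Tendsto.liminf_eq (tendsto_const_nhds.congr' ?_)).symm
          filter_upwards [eventually_ge_atTop ⌈U x⌉₊] with K hK
          rw [min_eq_left (Nat.ceil_le.1 hK)]
      _ ≤ liminf (fun K : ℕ => ∫⁻ x, ENNReal.ofReal ((min (U x) (K : ℝ)) ^ (k + 1))
            ∂(torusMeasure b)) atTop := lintegral_liminf_le' hmK
      _ ≤ ENNReal.ofReal (C₂ / (c / 2)) := by
          refine (liminf_le_liminf (Eventually.of_forall fun K => ?_)).trans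
            (liminf_const (f := (atTop : Filter ℕ)) _).le
          have hσ0 : ∀ x, 0 ≤ (min (U x) (K : ℝ)) ^ (k + 1) := fun x =>
            pow_nonneg (le_min (hU0 x) (Nat.cast_nonneg K)) _
          have hi : Integrable (fun x => (min (U x) (K : ℝ)) ^ (k + 1)) (torusMeasure b) := by
            refine Integrable.of_bound ((hUi.aemeasurable.min
              aemeasurable_const).pow_const _).aestronglyMeasurable ((K : ℝ) ^ (k + 1))
              (ae_of_all _ fun x => ?_)
            rw [Real.norm_of_nonneg (hσ0 x)]
            exact pow_le_pow_left₀ (le_min (hU0 x) (Nat.cast_nonneg K)) (min_le_right _ _) _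
          rw [← ofReal_integral_eq_lintegral_ofReal hi (ae_of_all _ hσ0)]
          exact ENNReal.ofReal_le_ofReal (htrunc K)
  have hint : Integrable (fun x => U x ^ (k + 1)) (torusMeasure b) := by
    refine ⟨hm, ?_⟩
    rw [hasFiniteIntegral_iff_ofReal (ae_of_all _ hnn)]
    exact hfatou.trans_lt ENNReal.ofReal_lt_top
  refine ⟨hint, ?_⟩
  have hC0 : 0 ≤ C₂ / (c / 2) := by
    refine le_trans (integral_nonneg fun x => ?_) (htrunc 0)
    exact pow_nonneg (le_min (hU0 x) (Nat.cast_nonneg 0)) _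
  rw [← ENNReal.ofReal_le_ofReal_iff hC0, ofReal_integral_eq_lintegral_ofReal hint
    (ae_of_all _ hnn)]
  exact hfatou

/-! ### The Poisson equation for `exp v - v` -/

lemma gradient_apply (φ : Plane → ℝ) (x : Plane) (i : Fin 2) :
    gradient φ x i = fderiv ℝ φ x (EuclideanSpace.single i 1) := by
  have h := inner_gradient_left (𝕜 := ℝ) (f := φ) (x := x) (y := EuclideanSpace.single i (1 : ℝ))
  rw [EuclideanSpace.inner_single_right, one_mul, conj_trivial] at h
  exact h

lemma integral_mul_fderiv_of_hasWeakGradient {v : Plane → ℝ} {g : Plane → Plane}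
    (h : HasWeakGradient b v g) (i : Fin 2) {φ : Plane → ℝ} (hφ : IsTorusTest b φ) :
    ∫ x, v x * fderiv ℝ φ x (EuclideanSpace.single i 1) ∂(torusMeasure b) =
      -∫ x, g x i * φ x ∂(torusMeasure b) := by
  obtain ⟨C, hC⟩ := hφ.exists_abs_le
  obtain ⟨C', hC'⟩ := hφ.exists_norm_fderiv_le
  have hgc : Continuous (gradient φ) :=
    (InnerProductSpace.toDual ℝ Plane).symm.continuous.comp hφ.continuous_fderiv
  have h1 : Integrable (fun x => v x • gradient φ x) (torusMeasure b) := by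
    refine h.integrable.smul_bdd C' hgc.aestronglyMeasurable (ae_of_all _ fun x => ?_)
    rw [gradient, LinearIsometryEquiv.norm_map]
    exact hC' x
  have h2 : Integrable (fun x => φ x • g x) (torusMeasure b) :=
    h.integrable_grad.bdd_smul C hφ.continuous.aestronglyMeasurable (ae_of_all _ hC)
  have h3 := congrArg (fun z : Plane => EuclideanSpace.proj (𝕜 := ℝ) i z) (h.integral_eq φ hφ)
  simp only [map_neg] at h3
  rw [← ContinuousLinearMap.integral_comp_comm _ h1,
    ← ContinuousLinearMap.integral_comp_comm _ h2] at h3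
  simp only [map_smul, PiLp.proj_apply, gradient_apply, smul_eq_mul] at h3
  rw [h3]
  simp only [mul_comm]

lemma exp_le_two_add (t : ℝ) : Real.exp t ≤ 2 + Real.exp t * (1 - Real.exp t) ^ 2 := by
  have h0 := Real.exp_pos t
  rcases le_total (Real.exp t) 2 with h | h
  · have : 0 ≤ Real.exp t * (1 - Real.exp t) ^ 2 := by positivity
    linarith
  · have : 1 ≤ (1 - Real.exp t) ^ 2 := by nlinarith
    nlinarith

/-- The consequences of the vortex equation that are used below: the nonlinear term has mass
`4 π N ε²`, and `exp v - v` satisfies a Poisson equation in the sense of distributions. -/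
structure SolvesPoisson (b : Module.Basis (Fin 2) ℝ Plane) (p : Fin N → Plane) (ε : ℝ)
    (v : Plane → ℝ) : Prop where
  periodic : DoublyPeriodic b v
  integrable : Integrable v (torusMeasure b)
  integrable_exp : Integrable (fun x => Real.exp (v x)) (torusMeasure b)
  integrable_nonlin :
    Integrable (fun x => Real.exp (v x) * (1 - Real.exp (v x)) ^ 2) (torusMeasure b)
  integral_nonlin : ∫ x, Real.exp (v x) * (1 - Real.exp (v x)) ^ 2 ∂(torusMeasure b) =
    4 * Real.pi * N * ε ^ 2
  integral_lap : ∀ φ, IsTorusTest b φ →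
    ∫ x, (Real.exp (v x) - v x) * lap φ x ∂(torusMeasure b) =
      1 / ε ^ 2 * ∫ x, Real.exp (v x) * (1 - Real.exp (v x)) ^ 2 * φ x ∂(torusMeasure b)
        - 4 * Real.pi * ∑ j, φ (p j)

lemma solvesPoisson_of_isVortexSolution {p : Fin N → Plane} {ε : ℝ} (hε : 0 < ε) {v : Plane → ℝ}
    (h : IsVortexSolution b p ε v) : SolvesPoisson b p ε v := by
  obtain ⟨g, hg, hfl, hnl, heq⟩ := h
  have hvi := hg.integrable
  have hexp : Integrable (fun x => Real.exp (v x)) (torusMeasure b) := by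
    refine Integrable.mono' ((integrable_const (2 : ℝ)).add hnl)
      (Real.continuous_exp.comp_aestronglyMeasurable hvi.1) (ae_of_all _ fun x => ?_)
    rw [Real.norm_of_nonneg (Real.exp_pos _).le]
    exact exp_le_two_add _
  have hγ : ∀ i, Integrable (fun x => g x i) (torusMeasure b) := fun i =>
    (EuclideanSpace.proj (𝕜 := ℝ) i).integrable_comp hg.integrable_grad
  have hflγ : ∀ i, Integrable (fun x => (1 - Real.exp (v x)) * g x i) (torusMeasure b) := fun i =>
    (EuclideanSpace.proj (𝕜 := ℝ) i).integrable_comp hfl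
  have hexpγ : ∀ i, Integrable (fun x => Real.exp (v x) * g x i) (torusMeasure b) := fun i => by
    refine ((hγ i).sub (hflγ i)).congr (ae_of_all _ fun x => ?_)
    simp only [Pi.sub_apply]
    ring
  have hdir : ∀ i, ∀ φ, IsTorusTest b φ → ∫ x, (Real.exp (v x) - v x) *
      fderiv ℝ φ x (EuclideanSpace.single i 1) ∂(torusMeasure b) =
      ∫ x, (1 - Real.exp (v x)) * g x i * φ x ∂(torusMeasure b) := by
    intro i φ hφ
    have hγp : DoublyPeriodic b (fun x => g x i) := hg.periodic_grad.comp fun z : Plane => z i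
    have h1 := integral_exp_mul_fderiv hg.periodic hvi hγp (hγ i)
      (fun φ hφ => integral_mul_fderiv_of_hasWeakGradient hg i hφ) hexp (hexpγ i) hφ
    have h2 := integral_mul_fderiv_of_hasWeakGradient hg i hφ
    simp only [sub_mul, one_mul]
    rw [integral_sub (hexp.mul_test (hφ.dirDeriv _)) (hvi.mul_test (hφ.dirDeriv _)), h1, h2,
      integral_sub ((hγ i).mul_test hφ) ((hexpγ i).mul_test hφ)]
    ring
  have hflux : ∀ φ, IsTorusTest b φ → ∫ x, (Real.exp (v x) - v x) * lap φ x ∂(torusMeasure b) =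
      ∫ x, inner ℝ ((1 - Real.exp (v x)) • g x) (gradient φ x) ∂(torusMeasure b) := by
    intro φ hφ
    have hin : ∀ x, inner ℝ ((1 - Real.exp (v x)) • g x) (gradient φ x) =
        ∑ i, (1 - Real.exp (v x)) * g x i * fderiv ℝ φ x (EuclideanSpace.single i 1) := fun x => by
      rw [inner_gradient_right, conj_trivial, clm_apply_eq_sum]
      rfl
    simp only [hin, lap, Finset.mul_sum]
    rw [integral_finsetSum, integral_finsetSum]
    · exact Finset.sum_congr rfl fun i _ => hdir i _ (hφ.dirDeriv _)
    · exact fun i _ => (hflγ i).mul_test (hφ.dirDeriv _)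
    · exact fun i _ => (hexp.sub hvi).mul_test ((hφ.dirDeriv _).dirDeriv _)
  refine ⟨hg.periodic, hvi, hexp, hnl, ?_, fun φ hφ => ?_⟩
  · have h1 := heq (fun _ => 1) (isTorusTest_const 1)
    have h2 : ∀ x : Plane, gradient (fun _ : Plane => (1 : ℝ)) x = 0 := fun x => by
      simp [gradient]
    simp only [h2, inner_zero_right, integral_zero, neg_zero, zero_add, mul_one,
      Finset.sum_const, Finset.card_univ, Fintype.card_fin, nsmul_eq_mul] at h1
    field_simp at h1
    linarith
  · have h1 := heq φ hφ
    rw [hflux φ hφ]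
    linarith

lemma integral_lap_eq_zero {φ : Plane → ℝ} (hφ : IsTorusTest b φ) :
    ∫ x, lap φ x ∂(torusMeasure b) = 0 := by
  have h1 : ∀ ψ, IsTorusTest b ψ → ∀ a, ∫ x, fderiv ℝ ψ x a ∂(torusMeasure b) = 0 := by
    intro ψ hψ a
    have h2 : corr b (fun _ => 1) ψ = fun _ => ∫ x, ψ x ∂(torusMeasure b) := by
      ext z
      simp only [corr, one_mul]
      exact integral_torus_add hψ.periodic z
    have h3 := fderiv_corr_apply (integrable_const (1 : ℝ)) hψ 0 a
    rw [h2] at h3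
    simpa [corr] using h3.symm
  simp only [lap]
  rw [integral_finsetSum _ fun i _ => ((hφ.dirDeriv _).dirDeriv _).integrable]
  exact Finset.sum_eq_zero fun i _ => h1 _ (hφ.dirDeriv _) _

lemma one_le_exp_sub (t : ℝ) : 1 ≤ Real.exp t - t := by
  linarith [Real.add_one_le_exp t]

lemma abs_le_exp_sub (t : ℝ) : |t| ≤ Real.exp t - t := by
  have h0 := Real.exp_pos t
  rcases le_total t 0 with h | h
  · rw [abs_of_nonpos h]
    linarith
  · rw [abs_of_nonneg h]
    nlinarith [Real.quadratic_le_exp_of_nonneg h, sq_nonneg (t - 1)]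

namespace SolvesPoisson

variable {p : Fin N → Plane} {ε : ℝ} {v : Plane → ℝ}

lemma integrable_exp_sub (h : SolvesPoisson b p ε v) :
    Integrable (fun x => Real.exp (v x) - v x) (torusMeasure b) := h.integrable_exp.sub h.integrable

lemma neg_le_integral_lap (h : SolvesPoisson b p ε v) {φ : Plane → ℝ} (hφ : IsTorusTest b φ)
    (h0 : ∀ x, 0 ≤ φ x) : -(4 * Real.pi * ∑ j, φ (p j)) ≤
      ∫ x, (Real.exp (v x) - v x) * lap φ x ∂(torusMeasure b) := by
  rw [h.integral_lap φ hφ]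
  have : 0 ≤ ∫ x, Real.exp (v x) * (1 - Real.exp (v x)) ^ 2 * φ x ∂(torusMeasure b) :=
    integral_nonneg fun x => mul_nonneg (by positivity) (h0 x)
  have h2 : 0 ≤ 1 / ε ^ 2 * ∫ x, Real.exp (v x) * (1 - Real.exp (v x)) ^ 2 * φ x
      ∂(torusMeasure b) := mul_nonneg (by positivity) this
  linarith

lemma abs_integral_lap_le (h : SolvesPoisson b p ε v) (hε : 0 < ε) {φ : Plane → ℝ}
    (hφ : IsTorusTest b φ) (h1 : ∀ x, |φ x| ≤ 1) :
    |∫ x, (Real.exp (v x) - v x) * lap φ x ∂(torusMeasure b)| ≤ 8 * Real.pi * N := by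
  rw [h.integral_lap φ hφ]
  have e1 : |1 / ε ^ 2 * ∫ x, Real.exp (v x) * (1 - Real.exp (v x)) ^ 2 * φ x
      ∂(torusMeasure b)| ≤ 4 * Real.pi * N := by
    have : |∫ x, Real.exp (v x) * (1 - Real.exp (v x)) ^ 2 * φ x ∂(torusMeasure b)| ≤
        4 * Real.pi * N * ε ^ 2 := by
      rw [← h.integral_nonlin]
      refine abs_integral_le_integral_abs.trans (integral_mono
        (h.integrable_nonlin.mul_test hφ).abs h.integrable_nonlin fun x => ?_)
      have hn : 0 ≤ Real.exp (v x) * (1 - Real.exp (v x)) ^ 2 := by positivity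
      simp only [abs_mul _ (φ x), abs_of_nonneg hn]
      exact mul_le_of_le_one_right hn (h1 x)
    rw [abs_mul, abs_of_pos (by positivity), one_div, inv_mul_le_iff₀ (by positivity)]
    linarith
  have e2 : |4 * Real.pi * ∑ j, φ (p j)| ≤ 4 * Real.pi * N := by
    rw [abs_mul, abs_of_pos (by positivity)]
    refine mul_le_mul_of_nonneg_left ?_ (by positivity)
    refine (Finset.abs_sum_le_sum_abs _ _).trans ((Finset.sum_le_sum fun j _ => h1 _).trans ?_)
    simp
  refine (abs_sub _ _).trans ?_
  linarith

end SolvesPoisson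

/-! ### Convergence of sequences of solutions -/

lemma exists_seq_tendsto_ae_zero {F : ℕ → Plane → ℝ} (hF : ∀ n, Integrable (F n) (torusMeasure b))
    (h : Tendsto (fun n => ∫ x, |F n x| ∂(torusMeasure b)) atTop (𝓝 0)) :
    ∃ s : ℕ → ℕ, StrictMono s ∧
      ∀ᵐ x ∂(torusMeasure b), Tendsto (fun n => F (s n) x) atTop (𝓝 0) := by
  have h1 : Tendsto (fun n => eLpNorm (F n - 0) 1 (torusMeasure b)) atTop (𝓝 0) := by
    have h2 : ∀ n, eLpNorm (F n - 0) 1 (torusMeasure b) =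
        ENNReal.ofReal (∫ x, |F n x| ∂(torusMeasure b)) := fun n => by
      rw [sub_zero, eLpNorm_one_eq_lintegral_enorm,
        ← ofReal_integral_norm_eq_lintegral_enorm (hF n)]
      rfl
    simp only [h2]
    simpa using ENNReal.tendsto_ofReal h
  exact (tendstoInMeasure_of_tendsto_eLpNorm one_ne_zero (fun n => (hF n).1)
    aestronglyMeasurable_zero h1).exists_seq_tendsto_ae

/-- The nonlinearity vanishes only at `0` and at `-∞`, so away from `0` it controls powers of `t`
up to a small multiple of the next power. -/
lemma exists_pow_le_nonlin {η : ℝ} (hη : 0 < η) (hη1 : η ≤ 1) {m : ℕ} (hm : 1 ≤ m) :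
    ∃ K : ℝ, ∀ t : ℝ, |t| ^ m ≤
      η * |t| ^ (m + 1) + η + K * (Real.exp t * (1 - Real.exp t) ^ 2) := by
  set κ := Real.exp (-(1 / η)) * (1 - Real.exp (-η)) ^ 2 with hκ
  have hlt : 0 < 1 - Real.exp (-η) := by
    have : Real.exp (-η) < 1 := Real.exp_lt_one_iff.2 (by linarith)
    linarith
  have hκ0 : 0 < κ := by positivity
  refine ⟨(1 / η) ^ m / κ, fun t => ?_⟩
  have hn : 0 ≤ (1 / η) ^ m / κ * (Real.exp t * (1 - Real.exp t) ^ 2) := by positivity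
  have hp : 0 ≤ η * |t| ^ (m + 1) := by positivity
  rcases le_total (1 / η) |t| with h | h
  · have h1 : 1 ≤ η * |t| := by
      rw [div_le_iff₀ hη] at h
      linarith
    have h2 : |t| ^ m ≤ η * |t| * |t| ^ m := le_mul_of_one_le_left (by positivity) h1
    rw [pow_succ] at *
    linarith
  rcases le_total |t| η with h' | h'
  · have h1 : |t| ^ m ≤ |t| := pow_le_of_le_one (abs_nonneg t) (h'.trans hη1) (by omega)
    linarith
  · have h1 : κ ≤ Real.exp t * (1 - Real.exp t) ^ 2 := by
      refine mul_le_mul (Real.exp_le_exp.2 (abs_le.1 h).1) ?_ (by positivity) (Real.exp_pos t).le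
      rcases le_abs.1 h' with h2 | h2
      · rw [← sq_abs (1 - Real.exp t), abs_sub_comm]
        refine pow_le_pow_left₀ hlt.le ?_ 2
        refine le_trans ?_ (le_abs_self _)
        linarith [Real.add_one_le_exp t, Real.add_one_le_exp (-η)]
      · refine pow_le_pow_left₀ hlt.le ?_ 2
        have := Real.exp_le_exp.2 (show t ≤ -η by linarith)
        linarith
    have h3 : |t| ^ m ≤ (1 / η) ^ m := pow_le_pow_left₀ (abs_nonneg t) h m
    have h4 : (1 / η) ^ m ≤ (1 / η) ^ m / κ * (Real.exp t * (1 - Real.exp t) ^ 2) := by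
      rw [div_mul_eq_mul_div, le_div_iff₀ hκ0]
      exact mul_le_mul_of_nonneg_left h1 (by positivity)
    linarith

/-- Both ends of the real line make `exp t - t` large, but the nonlinearity is small only at `-∞`. -/
lemma tendsto_atBot_of_tendsto_nonlin {t : ℕ → ℝ}
    (h1 : Tendsto (fun n => Real.exp (t n) - t n) atTop atTop)
    (h2 : Tendsto (fun n => Real.exp (t n) * (1 - Real.exp (t n)) ^ 2) atTop (𝓝 0)) :
    Tendsto t atTop atBot := by
  have h3 : ∀ᶠ n in atTop, t n ≤ Real.exp 1 + -(Real.exp (t n) - t n) := by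
    filter_upwards [h2.eventually (gt_mem_nhds one_pos)] with n hn
    have hlt : t n < 1 := by
      by_contra! hge
      have he : 2 ≤ Real.exp (t n) := by linarith [Real.add_one_le_exp (t n)]
      have : 1 ≤ (1 - Real.exp (t n)) ^ 2 := by nlinarith
      nlinarith
    have := Real.exp_le_exp.2 hlt.le
    linarith
  refine tendsto_atBot_mono' _ h3 ?_
  exact tendsto_atBot_add_const_left _ _ (tendsto_neg_atTop_atBot.comp h1)

section Sequences

variable {p : Fin N → Plane} {ε : ℕ → ℝ} {v : ℕ → Plane → ℝ}

lemma tendsto_integral_nonlin (hε : Tendsto ε atTop (𝓝 0))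
    (h : ∀ n, SolvesPoisson b p (ε n) (v n)) :
    Tendsto (fun n => ∫ x, Real.exp (v n x) * (1 - Real.exp (v n x)) ^ 2 ∂(torusMeasure b))
      atTop (𝓝 0) := by
  simp only [fun n => (h n).integral_nonlin]
  simpa using (hε.pow 2).const_mul (4 * Real.pi * N)

/-- If the `L¹` norms of `exp v - v` tend to infinity then, by the Poincaré inequality, the
functions themselves do so almost everywhere along a subsequence. -/
lemma exists_seq_tendsto_atBot (hε_pos : ∀ n, 0 < ε n) (hε : Tendsto ε atTop (𝓝 0))
    (h : ∀ n, SolvesPoisson b p (ε n) (v n))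
    (hinf : Tendsto (fun n => ∫ x, (Real.exp (v n x) - v n x) ∂(torusMeasure b)) atTop atTop) :
    ∃ s : ℕ → ℕ, StrictMono s ∧
      ∀ᵐ x ∂(torusMeasure b), Tendsto (fun n => v (s n) x) atTop atBot := by
  obtain ⟨C, hC0, hC⟩ := exists_poincare b
  set V := (torusMeasure b).real Set.univ with hV
  have hV0 : 0 < V := torusMeasure_real_univ_pos
  set U : ℕ → Plane → ℝ := fun n x => Real.exp (v n x) - v n x with hU
  set m : ℕ → ℝ := fun n => (∫ x, U n x ∂(torusMeasure b)) / V with hm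
  have hminf : Tendsto m atTop atTop := hinf.atTop_div_const hV0
  have hUi : ∀ n, Integrable (U n) (torusMeasure b) := fun n => (h n).integrable_exp_sub
  have hm1 : ∀ n, 1 ≤ m n := fun n => by
    rw [hm, le_div_iff₀ hV0, one_mul]
    have : ∫ _, (1 : ℝ) ∂(torusMeasure b) = V := by simp [hV]
    rw [← this]
    exact integral_mono (integrable_const _) (hUi n) fun x => one_le_exp_sub _
  have hosc : ∀ n, ∫ x, |U n x - m n| ∂(torusMeasure b) ≤ C * (8 * Real.pi * N) := by
    intro n
    have hi : Integrable (fun x => U n x - m n) (torusMeasure b) :=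
      (hUi n).sub (integrable_const _)
    refine hC _ _ ((h n).periodic.comp fun t => Real.exp t - t - m n) hi ?_ fun φ hφ hφ1 => ?_
    · rw [integral_sub (hUi n) (integrable_const _), integral_const, smul_eq_mul, ← hV]
      simp only [hm]
      field_simp
      ring
    · simp only [sub_mul (U n _)]
      rw [integral_sub ((hUi n).mul_test (isTorusTest_lap hφ))
        ((isTorusTest_lap hφ).integrable.const_mul _), integral_const_mul,
        integral_lap_eq_zero hφ, mul_zero, sub_zero]
      exact (h n).abs_integral_lap_le (hε_pos n) hφ hφ1
  obtain ⟨s, hs, hs'⟩ := exists_seq_tendsto_ae_zero (b := b) (F := fun n x => (U n x - m n) / m n)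
    (fun n => ((hUi n).sub (integrable_const _)).div_const _) (by
      refine squeeze_zero (fun n => integral_nonneg fun x => abs_nonneg _) (fun n => ?_)
        (hminf.const_div_atTop (C * (8 * Real.pi * N)))
      simp only [abs_div, abs_of_pos (one_pos.trans_le (hm1 n))]
      rw [integral_div]
      exact div_le_div_of_nonneg_right (hosc n) (zero_le_one.trans (hm1 n)))
  obtain ⟨r, hr, hr'⟩ := exists_seq_tendsto_ae_zero (b := b)
    (F := fun n x => Real.exp (v (s n) x) * (1 - Real.exp (v (s n) x)) ^ 2)
    (fun n => (h (s n)).integrable_nonlin) (by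
      have := (tendsto_integral_nonlin hε h).comp hs.tendsto_atTop
      refine this.congr fun n => integral_congr_ae (ae_of_all _ fun x => ?_)
      simp only
      rw [abs_of_nonneg (by positivity)])
  refine ⟨s ∘ r, hs.comp hr, ?_⟩
  filter_upwards [hs', hr'] with x hx1 hx2
  refine tendsto_atBot_of_tendsto_nonlin ?_ hx2
  have h1 : Tendsto (fun n => (U (s n) x - m (s n)) / m (s n) + 1) atTop (𝓝 (0 + 1)) :=
    hx1.add_const 1
  rw [zero_add] at h1
  have h2 := (h1.pos_mul_atTop one_pos (hminf.comp hs.tendsto_atTop)).comp hr.tendsto_atTop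
  refine h2.congr fun n => ?_
  have : m (s (r n)) ≠ 0 := (one_pos.trans_le (hm1 _)).ne'
  simp only [Function.comp]
  field_simp
  simp [hU]

/-- If the integrals of `exp v - v` are bounded, then `v` tends to `0` in every `Lᵐ`. -/
lemma tendsto_integral_abs_pow (hε : Tendsto ε atTop (𝓝 0))
    (h : ∀ n, SolvesPoisson b p (ε n) (v n)) {A : ℝ}
    (hA : ∀ n, ∫ x, (Real.exp (v n x) - v n x) ∂(torusMeasure b) ≤ A) {m : ℕ} (hm : 1 ≤ m) :
    (∀ n, Integrable (fun x => |v n x| ^ m) (torusMeasure b)) ∧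
      Tendsto (fun n => ∫ x, |v n x| ^ m ∂(torusMeasure b)) atTop (𝓝 0) := by
  have hpow : ∀ k : ℕ, 1 ≤ k → ∃ C, ∀ n, Integrable (fun x => |v n x| ^ (k + 1)) (torusMeasure b) ∧
      ∫ x, |v n x| ^ (k + 1) ∂(torusMeasure b) ≤ C := by
    intro k hk
    obtain ⟨C, hC⟩ := exists_integral_pow_le b p A hk
    refine ⟨C, fun n => ?_⟩
    obtain ⟨h1, h2⟩ := hC _ ((h n).periodic.comp fun t => Real.exp t - t) (h n).integrable_exp_sub
      (fun x => zero_le_one.trans (one_le_exp_sub _)) (hA n)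
      fun φ hφ h0 => (h n).neg_le_integral_lap hφ h0
    have hle : ∀ x, |v n x| ^ (k + 1) ≤ (Real.exp (v n x) - v n x) ^ (k + 1) := fun x =>
      pow_le_pow_left₀ (abs_nonneg _) (abs_le_exp_sub _) _
    have h3 : Integrable (fun x => |v n x| ^ (k + 1)) (torusMeasure b) :=
      h1.mono' ((h n).integrable.abs.1.pow _) (ae_of_all _ fun x => by
        rw [Real.norm_of_nonneg (by positivity)]; exact hle x)
    exact ⟨h3, (integral_mono h3 h1 hle).trans h2⟩
  obtain ⟨C, hC⟩ := hpow m hm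
  have hint : ∀ n, Integrable (fun x => |v n x| ^ m) (torusMeasure b) := by
    intro n
    rcases hm.eq_or_lt with rfl | h1
    · simpa using (h n).integrable.abs
    · obtain ⟨k, rfl⟩ : ∃ k, m = k + 1 := ⟨m - 1, by omega⟩
      obtain ⟨C', hC'⟩ := hpow k (by omega)
      exact (hC' n).1
  refine ⟨hint, ?_⟩
  set V := (torusMeasure b).real Set.univ with hV
  have hV0 : 0 < V := torusMeasure_real_univ_pos
  rw [Metric.tendsto_atTop']
  intro δ hδ
  set η := min 1 (δ / (2 * (|C| + V))) with hη
  have hη0 : 0 < η := by positivity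
  obtain ⟨K, hK⟩ := exists_pow_le_nonlin hη0 (min_le_left _ _) hm
  have hlim := (tendsto_integral_nonlin hε h).const_mul K
  rw [mul_zero] at hlim
  obtain ⟨n₀, hn₀⟩ := eventually_atTop.1 (hlim.eventually (gt_mem_nhds (half_pos hδ)))
  refine ⟨n₀, fun n hn => ?_⟩
  rw [Real.dist_eq, sub_zero, abs_of_nonneg (integral_nonneg fun x => by positivity)]
  have h1 : ∫ x, |v n x| ^ m ∂(torusMeasure b) ≤
      η * ∫ x, |v n x| ^ (m + 1) ∂(torusMeasure b) + η * V +
        K * ∫ x, Real.exp (v n x) * (1 - Real.exp (v n x)) ^ 2 ∂(torusMeasure b) := by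
    have i1 : Integrable (fun x => η * |v n x| ^ (m + 1) + η) (torusMeasure b) :=
      ((hC n).1.const_mul η).add (integrable_const _)
    have e : ∫ _, η ∂(torusMeasure b) = η * V := by
      rw [integral_const, smul_eq_mul, mul_comm]
    rw [← e, ← integral_const_mul, ← integral_const_mul,
      ← integral_add ((hC n).1.const_mul η) (integrable_const _),
      ← integral_add i1 ((h n).integrable_nonlin.const_mul K)]
    exact integral_mono (hint n) (i1.add ((h n).integrable_nonlin.const_mul K)) fun x => hK _
  have h2 : η * ∫ x, |v n x| ^ (m + 1) ∂(torusMeasure b) + η * V ≤ δ / 2 := by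
    calc _ ≤ η * |C| + η * V := by
          gcongr
          exact (hC n).2.trans (le_abs_self C)
      _ = η * (|C| + V) := by ring
      _ ≤ δ / (2 * (|C| + V)) * (|C| + V) := by gcongr; exact min_le_right _ _
      _ = δ / 2 := by field_simp
  linarith [hn₀ n hn.le]

lemma memLp_and_tendsto_eLpNorm (hε : Tendsto ε atTop (𝓝 0))
    (h : ∀ n, SolvesPoisson b p (ε n) (v n)) {A : ℝ}
    (hA : ∀ n, ∫ x, (Real.exp (v n x) - v n x) ∂(torusMeasure b) ≤ A) {q : ℝ≥0∞} (hq1 : 1 < q)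
    (hq : q ≠ ⊤) :
    (∀ n, MemLp (v n) q (torusMeasure b)) ∧
      Tendsto (fun n => eLpNorm (v n) q (torusMeasure b)) atTop (𝓝 0) := by
  -- on a finite measure space it suffices to treat an integer exponent `m > q`
  obtain ⟨m, hqm⟩ := exists_nat_gt q.toReal
  have hm0 : 0 < q.toReal := ENNReal.toReal_pos (one_pos.trans hq1).ne' hq
  have hm1 : 1 ≤ m := Nat.one_le_cast.1 (by
    have : (0 : ℝ) < m := hm0.trans hqm
    exact_mod_cast this : (1 : ℝ) ≤ m)
  have hqm' : q ≤ m := by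
    rw [← ENNReal.ofReal_toReal hq, ← ENNReal.ofReal_natCast]
    exact ENNReal.ofReal_le_ofReal hqm.le
  obtain ⟨hint, hlim⟩ := tendsto_integral_abs_pow hε h hA hm1
  have hmne : (m : ℝ≥0∞) ≠ 0 := by exact_mod_cast (by omega : m ≠ 0)
  have hmem : ∀ n, MemLp (v n) m (torusMeasure b) := fun n => by
    rw [← integrable_norm_rpow_iff (h n).integrable.1 hmne (ENNReal.natCast_ne_top m)]
    simpa using hint n
  have heq : ∀ n, eLpNorm (v n) m (torusMeasure b) =
      ENNReal.ofReal ((∫ x, |v n x| ^ m ∂(torusMeasure b)) ^ (m : ℝ)⁻¹) := fun n => by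
    rw [(hmem n).eLpNorm_eq_integral_rpow_norm hmne (ENNReal.natCast_ne_top m)]
    simp
  refine ⟨fun n => (hmem n).mono_exponent hqm', ?_⟩
  have h1 : Tendsto (fun n => eLpNorm (v n) m (torusMeasure b)) atTop (𝓝 0) := by
    simp only [heq]
    have hpos : (0 : ℝ) < (m : ℝ)⁻¹ := by positivity
    have := hlim.rpow_const (p := (m : ℝ)⁻¹) (Or.inr hpos.le)
    rw [Real.zero_rpow hpos.ne'] at this
    simpa using ENNReal.tendsto_ofReal this
  set c := torusMeasure b Set.univ ^ (1 / q.toReal - 1 / (m : ℝ≥0∞).toReal) with hc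
  have hcne : c ≠ ∞ := by
    refine ENNReal.rpow_ne_top_of_nonneg ?_ torusMeasure_univ_ne_top
    rw [ENNReal.toReal_natCast, sub_nonneg]
    exact one_div_le_one_div_of_le hm0 hqm.le
  have h2 : Tendsto (fun n => eLpNorm (v n) m (torusMeasure b) * c) atTop (𝓝 0) := by
    simpa using ENNReal.Tendsto.mul_const h1 (Or.inr hcne)
  exact tendsto_of_tendsto_of_tendsto_of_le_of_le tendsto_const_nhds h2 (fun n => zero_le)
    fun n => eLpNorm_le_eLpNorm_mul_rpow_measure_univ hqm' (h n).integrable.1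

end Sequences

end TorusVortex

theorem theorem1p1 (b : Module.Basis (Fin 2) ℝ Plane) (N : ℕ) (p : Fin N → Plane)
    (ε : ℕ → ℝ) (hε_pos : ∀ n, 0 < ε n)
    (hε : Filter.Tendsto ε Filter.atTop (nhds 0))
    (v : ℕ → Plane → ℝ) (hv : ∀ n, IsVortexSolution b p (ε n) (v n)) :
    ∃ s : ℕ → ℕ, StrictMono s ∧
      (((∀ᵐ x ∂(torusMeasure b),
            Filter.Tendsto (fun n => v (s n) x) Filter.atTop (nhds 0)) ∧
          ∀ q : ENNReal, 1 < q → q ≠ ⊤ →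
            (∀ n, MeasureTheory.MemLp (v (s n)) q (torusMeasure b)) ∧
            Filter.Tendsto (fun n => MeasureTheory.eLpNorm (v (s n)) q (torusMeasure b))
              Filter.atTop (nhds 0)) ∨
        ∀ᵐ x ∂(torusMeasure b),
          Filter.Tendsto (fun n => v (s n) x) Filter.atTop Filter.atBot) := by
  have h := fun n => TorusVortex.solvesPoisson_of_isVortexSolution (hε_pos n) (hv n)
  by_cases hinf : Tendsto (fun n => ∫ x, (Real.exp (v n x) - v n x) ∂(torusMeasure b)) atTop atTop
  · obtain ⟨s, hs, hs'⟩ := TorusVortex.exists_seq_tendsto_atBot hε_pos hε h hinf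
    exact ⟨s, hs, Or.inr hs'⟩
  · rw [tendsto_atTop] at hinf
    push Not at hinf
    obtain ⟨A, hA⟩ := hinf
    obtain ⟨s, hs, hsA⟩ := extraction_of_frequently_atTop hA
    have hεs := hε.comp hs.tendsto_atTop
    have hA' : ∀ n, ∫ x, (Real.exp (v (s n) x) - v (s n) x) ∂(torusMeasure b) ≤ A :=
      fun n => (hsA n).le
    obtain ⟨r, hr, hr'⟩ := TorusVortex.exists_seq_tendsto_ae_zero (b := b)
      (F := fun n => v (s n)) (fun n => (h (s n)).integrable) (by
        simpa using (TorusVortex.tendsto_integral_abs_pow hεs (fun n => h (s n)) hA' le_rfl).2)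
    refine ⟨s ∘ r, hs.comp hr, Or.inl ⟨hr', fun q hq1 hq => ?_⟩⟩
    exact TorusVortex.memLp_and_tendsto_eLpNorm (hεs.comp hr.tendsto_atTop)
      (fun n => h (s (r n))) (fun n => hA' (r n)) hq1 hq
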